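/- Let $d,q\in\mathbb N$. For each finite $\Lambda\subset\mathbb Z^d$ let $\mathfrak U_\Lambda$ be the algebra of linear operators on $\bigotimes_{x\in\Lambda}\mathbb C^q$, identified with a subalgebra of $\mathfrak U_{\Lambda'}$ (via $A\mapsto A\otimes\mathbb I$) when $\Lambda\subseteq\Lambda'$. Let $\mathfrak U_{\mathbb Z^d}$ be the completion of $\bigcup_\Lambda\mathfrak U_\Lambda$ in the operator norm and, for $\Gamma\subseteq\mathbb Z^d$, let $\mathfrak U_\Gamma\subseteq\mathfrak U_{\mathbb Z^d}$ be the norm closure of $\bigcup_{X\subseteq\Gamma,\ X\text{ finite}}\mathfrak U_X$. A state is a positive linear functional $\rho$ on $\mathfrak U_{\mathbb Z^d}$ with $\rho(\mathbb I)=1$; its marginal $\rho_\Gamma$ is its restriction to $\mathfrak U_\Gamma$, which for finite $\Gamma$ is identified with the density matrix satisfying $\rho(A)=\mathrm{Tr}[\rho_\Gamma A]$ for all $A\in\mathfrak U_\Gamma$. Let $\tau_x$ be the translation by $x\in\mathbb Z^d$ on $\mathfrak U_{\mathbb Z^d}$, acting on states by $(\tau_x\rho)(\tau_xA)=\rho(A)$;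 $\rho$ is translation invariant if $\tau_x\rho=\rho$ for all $x$. For a finite set $\Lambda$ and a self-adjoint traceless operator $\Delta\in\mathfrak U_\Lambda$ let $$\|\Delta\|_{W_1}=\tfrac12\min\Big\{\sum_{x\in\Lambda}\|\Delta^{(x)}\|_1:\ \Delta^{(x)}\in\mathfrak U_\Lambda\text{ self-adjoint and traceless},\ \mathrm{Tr}_x\Delta^{(x)}=0,\ \sum_{x\in\Lambda}\Delta^{(x)}=\Delta\Big\},$$ where $\mathrm{Tr}_x$ is the partial trace over the site $x$ and $\|A\|_1=\mathrm{Tr}\sqrt{A^\dagger A}$. For $a\in\mathbb N_+^d$ let $\Lambda_a=\{x\in\mathbb Z^d:-a_i\le x_i<a_i\ \forall i\}$; $a\to\infty$ means that every $a_i\to\infty$. For translation-invariant states $\rho,\sigma$ let $$w_1(\rho,\sigma)=\lim_{a\to\infty}\frac{\|\rho_{\Lambda_a}-\sigma_{\Lambda_a}\|_{W_1}}{|\Lambda_a|},$$ and let $\|\rho-\sigma\|_{w_1}$ be the infimum of all $c\ge0$ for which there exist states $\rho',\sigma'$ (not necessarily translation invariant) with $\rho'_{\mathbb Z^d\setminus\{0\}}=\sigma'_{\mathbb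 Z^d\setminus\{0\}}$ and $$\rho_\Lambda-\sigma_\Lambda=c\sum_{x\in\Lambda}\big((\tau_x\rho')_\Lambda-(\tau_x\sigma')_\Lambda\big)\qquad\text{for every finite }\Lambda\subset\mathbb Z^d.$$ **Theorem.** For all translation-invariant states $\rho,\sigma$, the limit defining $w_1(\rho,\sigma)$ exists, the set of such $c$ is nonempty, and $$w_1(\rho,\sigma)=\|\rho-\sigma\|_{w_1}.$$ -/

import Mathlib

open scoped ComplexOrder MatrixOrder

namespace SpinLattice

/-! ### Finite spin systems -/

/-- The algebra of linear operators on `⨂_{x ∈ ι} ℂ^q` for a finite set of sites `ι`, as matrices in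
the canonical product basis (indexed by the configurations `ι → Fin q`). -/
abbrev FinOp (ι : Type*) (q : ℕ) : Type _ := Matrix (ι → Fin q) (ι → Fin q) ℂ

/-- The configuration on `ι` with the value `s` at `x` and `η` elsewhere. -/
def insertSite {ι : Type*} [DecidableEq ι] {q : ℕ} (x : ι) (s : Fin q)
    (η : {y : ι // y ≠ x} → Fin q) : ι → Fin q :=
  fun y => if h : y = x then s else η ⟨y, h⟩

/-- The partial trace `Tr_x` over the site `x`. -/
def partialTrace {ι : Type*} [DecidableEq ι] {q : ℕ} (x : ι) (A : FinOp ι q) :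
    FinOp {y : ι // y ≠ x} q :=
  Matrix.of fun η ζ => ∑ s : Fin q, A (insertSite x s η) (insertSite x s ζ)

/-- The trace norm `‖A‖₁ = Tr √(A† A)`. -/
noncomputable def traceNorm {n : Type*} [Fintype n] [DecidableEq n] (A : Matrix n n ℂ) : ℝ :=
  (CFC.sqrt (A.conjTranspose * A)).trace.re

/-- The quantum `W₁` norm of a self-adjoint traceless operator `Δ`: half the minimum of
`∑ₓ ‖Δ⁽ˣ⁾‖₁` over the families of self-adjoint traceless operators with `Tr_x Δ⁽ˣ⁾ = 0` and
`∑ₓ Δ⁽ˣ⁾ = Δ`. -/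
noncomputable def W1Norm {ι : Type*} [Fintype ι] [DecidableEq ι] {q : ℕ} (Δ : FinOp ι q) : ℝ :=
  1 / 2 * sInf {r : ℝ | ∃ D : ι → FinOp ι q,
    (∀ x, (D x).IsHermitian ∧ (D x).trace = 0 ∧ partialTrace x (D x) = 0) ∧
    ∑ x, D x = Δ ∧ r = ∑ x, traceNorm (D x)}

/-! ### The quasi-local algebra

For a set of sites `V`, all local operators act on the Hilbert space `ℓ²(V → Fin q)`: an operator
on the finite region `Λ` acts on the coordinates in `Λ` and leaves the other coordinates untouched.
This representation is isometric on every local algebra and compatible with the inclusions of the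
local algebras, so that the norm closure of the union of the local algebras is the completion. -/

/-- The Hilbert space `ℓ²(V → Fin q)`. -/
abbrev Hilb (V : Type*) (q : ℕ) : Type _ := lp (fun _ : V → Fin q => ℂ) 2

/-- The configuration which is `η` on `Λ` and `ω` outside `Λ`. -/
def overwrite {V : Type*} [DecidableEq V] {q : ℕ} (Λ : Finset V) (η : Λ → Fin q)
    (ω : V → Fin q) : V → Fin q :=
  fun v => if h : v ∈ Λ then η ⟨v, h⟩ else ω v

/-- The restriction of a configuration to `Λ`. -/
def restrict {V : Type*} {q : ℕ} (Λ : Finset V) (ω : V → Fin q) : Λ → Fin q :=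
  fun v => ω v

theorem hasSum_norm_sq {V : Type*} {q : ℕ} (ψ : Hilb V q) : HasSum (fun ω => ‖ψ ω‖ ^ 2) (‖ψ‖ ^ 2) := by
  have := lp.hasSum_norm (p := 2) (by norm_num) ψ
  simpa using this

theorem memlp_of_summable {V : Type*} {q : ℕ} {ψ : (V → Fin q) → ℂ} (h : Summable fun ω => ‖ψ ω‖ ^ 2) :
    Memℓp ψ 2 := memℓp_gen (by simpa using h)

section

variable {V : Type*} [DecidableEq V] {q : ℕ} (Λ : Finset V)

@[simp] theorem restrict_overwrite (η : Λ → Fin q) (ω : V → Fin q) :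
    restrict Λ (overwrite Λ η ω) = η := by
  ext v; simp [restrict, overwrite]

@[simp] theorem overwrite_overwrite (η ζ : Λ → Fin q) (ω : V → Fin q) :
    overwrite Λ η (overwrite Λ ζ ω) = overwrite Λ η ω := by
  ext v; by_cases h : v ∈ Λ <;> simp [overwrite, h]

@[simp] theorem overwrite_restrict (ω : V → Fin q) : overwrite Λ (restrict Λ ω) ω = ω := by
  ext v; by_cases h : v ∈ Λ <;> simp [restrict, overwrite, h]

/-- The involution exchanging the part of a configuration inside `Λ` with a given one. -/
def swapEquiv : (V → Fin q) × (Λ → Fin q) ≃ (V → Fin q) × (Λ → Fin q) where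
  toFun p := (overwrite Λ p.2 p.1, restrict Λ p.1)
  invFun p := (overwrite Λ p.2 p.1, restrict Λ p.1)
  left_inv p := by simp
  right_inv p := by simp

/-- The action of a local operator on functions of the configurations. -/
def actFun (A : FinOp Λ q) (ψ : (V → Fin q) → ℂ) : (V → Fin q) → ℂ :=
  fun ω => ∑ η : Λ → Fin q, A (restrict Λ ω) η * ψ (overwrite Λ η ω)

theorem hasSum_swap (ψ : Hilb V q) :
    HasSum (fun p : (V → Fin q) × (Λ → Fin q) => ‖ψ (overwrite Λ p.2 p.1)‖ ^ 2)
      (Fintype.card (Λ → Fin q) * ‖ψ‖ ^ 2) := by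
  have h1 : HasSum (fun p : (Λ → Fin q) × (V → Fin q) => ‖ψ p.2‖ ^ 2)
      (Fintype.card (Λ → Fin q) * ‖ψ‖ ^ 2) := by
    have hs : Summable (fun p : (Λ → Fin q) × (V → Fin q) => ‖ψ p.2‖ ^ 2) := by
      rw [summable_prod_of_nonneg (fun p => by positivity)]
      exact ⟨fun _ => (hasSum_norm_sq ψ).summable, (hasSum_fintype _).summable⟩
    have h2 := hs.hasSum
    rw [hs.tsum_prod' (fun _ => (hasSum_norm_sq ψ).summable)] at h2
    simpa [(hasSum_norm_sq ψ).tsum_eq, tsum_fintype] using h2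
  have h2 := ((Equiv.prodComm (V → Fin q) (Λ → Fin q)).hasSum_iff
    (f := fun p : (Λ → Fin q) × (V → Fin q) => ‖ψ p.2‖ ^ 2)).mpr h1
  exact ((swapEquiv Λ).hasSum_iff
    (f := fun p : (V → Fin q) × (Λ → Fin q) => ‖ψ p.1‖ ^ 2)).mpr h2

theorem actFun_bound (A : FinOp Λ q) (ψ : (V → Fin q) → ℂ) (ω : V → Fin q) :
    ‖actFun Λ A ψ ω‖ ^ 2 ≤ (∑ η, ∑ ζ, ‖A η ζ‖ ^ 2) * ∑ η, ‖ψ (overwrite Λ η ω)‖ ^ 2 := by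
  have h1 : ‖actFun Λ A ψ ω‖ ≤ ∑ η, ‖A (restrict Λ ω) η‖ * ‖ψ (overwrite Λ η ω)‖ :=
    (norm_sum_le _ _).trans (le_of_eq (by simp))
  calc ‖actFun Λ A ψ ω‖ ^ 2
      ≤ (∑ η, ‖A (restrict Λ ω) η‖ * ‖ψ (overwrite Λ η ω)‖) ^ 2 := by gcongr
    _ ≤ (∑ η, ‖A (restrict Λ ω) η‖ ^ 2) * ∑ η, ‖ψ (overwrite Λ η ω)‖ ^ 2 :=
        Finset.sum_mul_sq_le_sq_mul_sq _ _ _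
    _ ≤ _ := by
        refine mul_le_mul_of_nonneg_right ?_ (by positivity)
        exact Finset.single_le_sum (f := fun η => ∑ ζ, ‖A η ζ‖ ^ 2)
          (fun _ _ => by positivity) (Finset.mem_univ _)

theorem hasSum_swap' (ψ : Hilb V q) :
    HasSum (fun ω : V → Fin q => ∑ η : Λ → Fin q, ‖ψ (overwrite Λ η ω)‖ ^ 2)
      (Fintype.card (Λ → Fin q) * ‖ψ‖ ^ 2) :=
  (hasSum_swap Λ ψ).prod_fiberwise fun _ => hasSum_fintype _

theorem summable_actFun (A : FinOp Λ q) (ψ : Hilb V q) :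
    Summable fun ω => ‖actFun Λ A ψ ω‖ ^ 2 :=
  .of_nonneg_of_le (fun _ => by positivity) (actFun_bound Λ A ψ)
    ((hasSum_swap' Λ ψ).summable.mul_left _)

theorem actFun_norm_le (A : FinOp Λ q) (ψ : Hilb V q) :
    ‖(⟨actFun Λ A ψ, memlp_of_summable (summable_actFun Λ A ψ)⟩ : Hilb V q)‖ ≤
      √((∑ η, ∑ ζ, ‖A η ζ‖ ^ 2) * Fintype.card (Λ → Fin q)) * ‖ψ‖ := by
  rw [← Real.sqrt_sq (norm_nonneg ψ), ← Real.sqrt_mul (by positivity)]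
  refine Real.le_sqrt_of_sq_le ?_
  rw [mul_assoc]
  exact hasSum_le (actFun_bound Λ A ψ) (hasSum_norm_sq (⟨actFun Λ A ψ, _⟩ : Hilb V q))
    ((hasSum_swap' Λ ψ).mul_left _)

/-- The bounded operator on `ℓ²(V → Fin q)` given by a local operator. -/
noncomputable def localOp (A : FinOp Λ q) : Hilb V q →L[ℂ] Hilb V q :=
  LinearMap.mkContinuous
    { toFun := fun ψ => ⟨actFun Λ A ψ, memlp_of_summable (summable_actFun Λ A ψ)⟩
      map_add' := fun φ ψ => by
        ext ω
        change actFun Λ A (fun ω => φ ω + ψ ω) ω = actFun Λ A φ ω + actFun Λ A ψ ω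
        simp [actFun, mul_add, Finset.sum_add_distrib]
      map_smul' := fun c ψ => by
        ext ω
        change actFun Λ A (fun ω => c * ψ ω) ω = c * actFun Λ A ψ ω
        simp [actFun, Finset.mul_sum, mul_left_comm] }
    _ (actFun_norm_le Λ A)

theorem localOp_apply (A : FinOp Λ q) (ψ : Hilb V q) (ω : V → Fin q) :
    localOp Λ A ψ ω = ∑ η : Λ → Fin q, A (restrict Λ ω) η * ψ (overwrite Λ η ω) := rfl

theorem inner_localOp (A : FinOp Λ q) (φ ψ : Hilb V q) :
    inner ℂ (localOp Λ A.conjTranspose φ) ψ = inner ℂ φ (localOp Λ A ψ) := by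
  have hs : Summable fun p : (V → Fin q) × (Λ → Fin q) =>
      (starRingEnd ℂ) (φ p.1) * (A (restrict Λ p.1) p.2 * ψ (overwrite Λ p.2 p.1)) := by
    have h1 : Summable fun p : (V → Fin q) × (Λ → Fin q) => ‖φ p.1‖ ^ 2 := by
      have := (hasSum_swap Λ φ).summable
      rw [← (swapEquiv Λ).summable_iff] at this
      simpa [Function.comp_def, swapEquiv] using this
    have h2 := (hasSum_swap Λ ψ).summable
    refine .of_norm_bounded ((h1.add h2).mul_left (∑ η, ∑ ζ, ‖A η ζ‖)) fun p => ?_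
    have hA : ‖A (restrict Λ p.1) p.2‖ ≤ ∑ η, ∑ ζ, ‖A η ζ‖ :=
      (Finset.single_le_sum (f := fun ζ => ‖A (restrict Λ p.1) ζ‖)
        (fun _ _ => by positivity) (Finset.mem_univ _)).trans
      (Finset.single_le_sum (f := fun η => ∑ ζ, ‖A η ζ‖)
        (fun _ _ => by positivity) (Finset.mem_univ _))
    have h3 : ‖φ p.1‖ * ‖ψ (overwrite Λ p.2 p.1)‖ ≤
        ‖φ p.1‖ ^ 2 + ‖ψ (overwrite Λ p.2 p.1)‖ ^ 2 := by
      nlinarith [sq_nonneg (‖φ p.1‖ - ‖ψ (overwrite Λ p.2 p.1)‖), sq_nonneg (‖φ p.1‖),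
        sq_nonneg (‖ψ (overwrite Λ p.2 p.1)‖)]
    calc _ = ‖A (restrict Λ p.1) p.2‖ * (‖φ p.1‖ * ‖ψ (overwrite Λ p.2 p.1)‖) := by
          simp; ring
      _ ≤ _ := by gcongr
  rw [lp.inner_eq_tsum, lp.inner_eq_tsum]
  have h1 : ∀ ω, inner ℂ (φ ω) (localOp Λ A ψ ω) = ∑' η : Λ → Fin q,
      (starRingEnd ℂ) (φ ω) * (A (restrict Λ ω) η * ψ (overwrite Λ η ω)) := by
    intro ω
    rw [tsum_fintype, localOp_apply]
    rw [RCLike.inner_apply, mul_comm, Finset.mul_sum]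
  have h2 : ∀ ω, inner ℂ (localOp Λ A.conjTranspose φ ω) (ψ ω) = ∑' η : Λ → Fin q,
      (starRingEnd ℂ) (φ (overwrite Λ η ω)) * (A η (restrict Λ ω) * ψ ω) := by
    intro ω
    rw [tsum_fintype, localOp_apply]
    simp only [RCLike.inner_apply, map_sum, map_mul, Finset.mul_sum, Matrix.conjTranspose_apply]
    refine Finset.sum_congr rfl fun η _ => ?_
    simp; ring
  have hs' := (swapEquiv Λ).summable_iff.mpr hs
  have e : ∀ p : (V → Fin q) × (Λ → Fin q), (starRingEnd ℂ) (φ ((swapEquiv Λ) p).1) *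
      (A (restrict Λ ((swapEquiv Λ) p).1) ((swapEquiv Λ) p).2 *
        ψ (overwrite Λ ((swapEquiv Λ) p).2 ((swapEquiv Λ) p).1)) =
      (starRingEnd ℂ) (φ (overwrite Λ p.2 p.1)) * (A p.2 (restrict Λ p.1) * ψ p.1) := by
    intro p; simp [swapEquiv]
  simp_rw [h1, h2]
  rw [← hs.tsum_prod, ← (swapEquiv Λ).tsum_eq, tsum_congr e]
  have hs'' : Summable fun p : (V → Fin q) × (Λ → Fin q) =>
      (starRingEnd ℂ) (φ (overwrite Λ p.2 p.1)) * (A p.2 (restrict Λ p.1) * ψ p.1) := by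
    simpa only [Function.comp_def, e] using hs'
  exact hs''.tsum_prod.symm

/-- The canonical embedding of the algebra of operators on the finite region `Λ`. -/
noncomputable def embed : FinOp Λ q →⋆ₐ[ℂ] (Hilb V q →L[ℂ] Hilb V q) where
  toFun := localOp Λ
  map_one' := by
    ext ψ ω
    simp [localOp_apply, Matrix.one_apply]
  map_mul' A B := by
    ext ψ ω
    simp only [localOp_apply, mul_apply_eq_comp, restrict_overwrite,
      overwrite_overwrite, Matrix.mul_apply, Finset.sum_mul, Finset.mul_sum]
    rw [Finset.sum_comm]
    simp [mul_assoc]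
  map_zero' := by
    ext ψ ω
    simp [localOp_apply]
  map_add' A B := by
    ext ψ ω
    simp [localOp_apply, add_mul, Finset.sum_add_distrib]
  commutes' c := by
    ext ψ ω
    simp [localOp_apply, Matrix.one_apply, Algebra.algebraMap_eq_smul_one]
  map_star' A := by
    rw [ContinuousLinearMap.star_eq_adjoint, ContinuousLinearMap.eq_adjoint_iff]
    exact inner_localOp Λ A

theorem embed_apply (A : FinOp Λ q) (ψ : Hilb V q) (ω : V → Fin q) :
    embed Λ A ψ ω = ∑ η : Λ → Fin q, A (restrict Λ ω) η * ψ (overwrite Λ η ω) := rfl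

/-- For `X ⊆ Y`, the operator `A ⊗ 𝕀` on `Y`. -/
def extendOp {X Y : Finset V} (h : X ⊆ Y) (A : FinOp X q) : FinOp Y q :=
  Matrix.of fun η ζ =>
    if ∀ v : Y, v.1 ∉ X → η v = ζ v then
      A (fun v => η ⟨v.1, h v.2⟩) (fun v => ζ ⟨v.1, h v.2⟩) else 0

theorem embed_extendOp {X Y : Finset V} (h : X ⊆ Y) (A : FinOp X q) :
    embed Y (extendOp h A) = embed X A := by
  ext ψ ω
  rw [embed_apply, embed_apply]
  symm
  refine Finset.sum_of_injOn (fun η : X → Fin q => restrict Y (overwrite X η ω)) ?_ (by simp) ?_ ?_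
  · intro η _ ζ _ hh
    funext v
    have := congrFun hh ⟨v.1, h v.2⟩
    simpa [restrict, overwrite] using this
  · intro ζ _ hζ
    have : ¬ ∀ v : Y, v.1 ∉ X → restrict Y ω v = ζ v := by
      intro hv
      refine hζ ⟨fun v => ζ ⟨v.1, h v.2⟩, by simp, ?_⟩
      funext v
      by_cases hX : v.1 ∈ X
      · simp [restrict, overwrite, hX]
      · simpa [restrict, overwrite, hX] using hv v hX
    rw [extendOp, Matrix.of_apply, if_neg this, zero_mul]
  · intro η _
    have h1 : ∀ v : Y, v.1 ∉ X → restrict Y ω v = restrict Y (overwrite X η ω) v := by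
      intro v hv; simp [restrict, overwrite, hv]
    have h2 : overwrite Y (restrict Y (overwrite X η ω)) ω = overwrite X η ω := by
      ext v
      by_cases hY : v ∈ Y
      · simp [restrict, overwrite, hY]
      · have hX : v ∉ X := fun hX => hY (h hX)
        simp [overwrite, hY, hX]
    rw [h2, extendOp, Matrix.of_apply, if_pos h1]
    congr 2
    funext v
    simp [restrict, overwrite]

theorem range_embed_mono {X Y : Finset V} (h : X ⊆ Y) :
    (embed X : FinOp X q →⋆ₐ[ℂ] _).range ≤ (embed Y).range := by
  rintro _ ⟨A, rfl⟩
  exact ⟨extendOp h A, embed_extendOp h A⟩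

end

/-- The union of the local algebras over the finite subsets of the region `Γ`. -/
noncomputable def strictlyLocalAlgebra {V : Type*} [DecidableEq V] (q : ℕ) (Γ : Set V) :
    StarSubalgebra ℂ (Hilb V q →L[ℂ] Hilb V q) where
  carrier := {T | ∃ X : Finset V, (X : Set V) ⊆ Γ ∧ T ∈ (embed X : FinOp X q →⋆ₐ[ℂ] _).range}
  mul_mem' := by
    rintro S T ⟨X, hX, hS⟩ ⟨Y, hY, hT⟩
    exact ⟨X ∪ Y, by simp [hX, hY], mul_mem (range_embed_mono Finset.subset_union_left hS)
      (range_embed_mono Finset.subset_union_right hT)⟩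
  add_mem' := by
    rintro S T ⟨X, hX, hS⟩ ⟨Y, hY, hT⟩
    exact ⟨X ∪ Y, by simp [hX, hY], add_mem (range_embed_mono Finset.subset_union_left hS)
      (range_embed_mono Finset.subset_union_right hT)⟩
  algebraMap_mem' c := ⟨∅, by simp, algebraMap_mem _ c⟩
  star_mem' := by
    rintro T ⟨X, hX, hT⟩
    exact ⟨X, hX, star_mem hT⟩

/-- The algebra `𝔘_Γ` of a (finite or infinite) region `Γ`: the norm closure of the union of the
local algebras over the finite subsets of `Γ`. -/
noncomputable def regionAlgebra {V : Type*} [DecidableEq V] (q : ℕ) (Γ : Set V) :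
    StarSubalgebra ℂ (Hilb V q →L[ℂ] Hilb V q) :=
  (strictlyLocalAlgebra q Γ).topologicalClosure

/-- The quasi-local algebra, as a type. -/
abbrev QuasiLocal (V : Type*) [DecidableEq V] (q : ℕ) : Type _ :=
  ↥(regionAlgebra q (Set.univ : Set V))

/-- The element of the quasi-local algebra given by an operator on the finite region `Λ`. -/
noncomputable def toQuasiLocal {V : Type*} [DecidableEq V] {q : ℕ} (Λ : Finset V)
    (A : FinOp Λ q) : QuasiLocal V q :=
  ⟨embed Λ A, StarSubalgebra.le_topologicalClosure _ ⟨Λ, by simp, A, rfl⟩⟩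

/-! ### Translations of the quasi-local algebra of `ℤ^d` -/

/-- The lattice `ℤ^d`. -/
abbrev Site (d : ℕ) : Type := Fin d → ℤ

/-- Reindexing functions of the configurations along a permutation of the configurations. -/
noncomputable def reindexLp {V : Type*} {q : ℕ}
    (e : (V → Fin q) ≃ (V → Fin q)) (ψ : Hilb V q) : Hilb V q :=
  ⟨fun ω => ψ (e ω), memlp_of_summable
    ((e.summable_iff (f := fun ω => ‖ψ ω‖ ^ 2)).mpr (hasSum_norm_sq ψ).summable)⟩

theorem reindexLp_apply {V : Type*} {q : ℕ}
    (e : (V → Fin q) ≃ (V → Fin q)) (ψ : Hilb V q) (ω : V → Fin q) :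
    reindexLp e ψ ω = ψ (e ω) := rfl

/-- The map `ω ↦ ω(· + x)` on configurations. -/
def configShift {d q : ℕ} (x : Site d) : (Site d → Fin q) ≃ (Site d → Fin q) where
  toFun ω := fun y => ω (y + x)
  invFun ω := fun y => ω (y - x)
  left_inv ω := by simp
  right_inv ω := by simp

/-- The unitary operator moving every configuration by `x`: `(U_x ψ)(ω) = ψ(ω(· + x))`, so that
the basis vector of a configuration `ω` is sent to that of `ω(· - x)`. -/
noncomputable def shiftUnitary {d q : ℕ} (x : Site d) :
    Hilb (Site d) q ≃ₗᵢ[ℂ] Hilb (Site d) q where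
  toFun ψ := reindexLp (configShift x) ψ
  invFun ψ := reindexLp (configShift x).symm ψ
  map_add' φ ψ := by ext ω; rfl
  map_smul' c ψ := by ext ω; rfl
  left_inv ψ := by ext ω; simp [reindexLp_apply]
  right_inv ψ := by ext ω; simp [reindexLp_apply]
  norm_map' ψ := by
    have h : ‖reindexLp (configShift x) ψ‖ ^ 2 = ‖ψ‖ ^ 2 :=
      (hasSum_norm_sq _).unique
        (((configShift x).hasSum_iff (f := fun ω => ‖ψ ω‖ ^ 2)).mpr (hasSum_norm_sq ψ))
    exact (sq_eq_sq₀ (norm_nonneg _) (norm_nonneg _)).mp h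

theorem shiftUnitary_apply {d q : ℕ} (x : Site d) (ψ : Hilb (Site d) q) (ω : Site d → Fin q) :
    shiftUnitary x ψ ω = ψ (fun y => ω (y + x)) := rfl

theorem shiftUnitary_symm_apply {d q : ℕ} (x : Site d) (ψ : Hilb (Site d) q)
    (ω : Site d → Fin q) :
    (shiftUnitary x).symm ψ ω = ψ (fun y => ω (y - x)) := rfl

/-- The translation by `x` on bounded operators, `T ↦ U_x T U_x†`. -/
noncomputable def shiftOp {d q : ℕ} (x : Site d) :
    (Hilb (Site d) q →L[ℂ] Hilb (Site d) q) ≃⋆ₐ[ℂ] (Hilb (Site d) q →L[ℂ] Hilb (Site d) q) :=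
  (shiftUnitary x).conjStarAlgEquiv

/-- The translate `Λ + x`. -/
def shiftFinset {d : ℕ} (x : Site d) (Λ : Finset (Site d)) : Finset (Site d) :=
  Λ.map (Equiv.addRight x).toEmbedding

/-- The translate of an operator on `Λ`, as an operator on `Λ + x`. -/
def shiftFinOp {d q : ℕ} (x : Site d) (Λ : Finset (Site d)) (A : FinOp Λ q) :
    FinOp (shiftFinset x Λ) q :=
  Matrix.of fun η ζ => A (fun v => η ⟨v + x, by simp [shiftFinset]⟩)
    (fun v => ζ ⟨v + x, by simp [shiftFinset]⟩)

theorem shiftOp_embed {d q : ℕ} (x : Site d) (Λ : Finset (Site d)) (A : FinOp Λ q) :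
    shiftOp x (embed Λ A) = embed (shiftFinset x Λ) (shiftFinOp x Λ A) := by
  ext ψ ω
  rw [embed_apply]
  simp only [shiftOp, LinearIsometryEquiv.conjStarAlgEquiv_apply_apply, shiftUnitary_apply,
    embed_apply, shiftUnitary_symm_apply]
  have hmem : ∀ v : Site d, v ∈ Λ ↔ Equiv.addRight x v ∈ shiftFinset x Λ := by
    simp [shiftFinset]
  refine Fintype.sum_equiv
    (((Equiv.addRight x).subtypeEquiv hmem).arrowCongr (Equiv.refl (Fin q))) _ _ fun η => ?_
  have h1 : (fun y => overwrite Λ η (fun y => ω (y + x)) (y - x)) = overwrite (shiftFinset x Λ)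
      ((((Equiv.addRight x).subtypeEquiv hmem).arrowCongr (Equiv.refl (Fin q))) η) ω := by
    funext y
    have : y - x ∈ Λ ↔ y ∈ shiftFinset x Λ := by
      simp [shiftFinset, ← sub_eq_add_neg]
    by_cases hy : y ∈ shiftFinset x Λ
    · have hy' := this.mpr hy
      rw [sub_eq_add_neg] at hy'
      simp [overwrite, hy, hy', Equiv.arrowCongr, sub_eq_add_neg]
    · simp [overwrite, hy, this]
  rw [h1]
  congr 1
  simp only [shiftFinOp, Matrix.of_apply]
  congr 1
  funext v
  simp [Equiv.arrowCongr]

theorem shiftOp_mem {d q : ℕ} (x : Site d) (T : QuasiLocal (Site d) q) :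
    shiftOp x (T : Hilb (Site d) q →L[ℂ] Hilb (Site d) q) ∈
      regionAlgebra q (Set.univ : Set (Site d)) := by
  have hc : Continuous fun T : Hilb (Site d) q →L[ℂ] Hilb (Site d) q => shiftOp x T := by
    let U : Hilb (Site d) q →L[ℂ] Hilb (Site d) q :=
      (shiftUnitary x).toContinuousLinearEquiv.toContinuousLinearMap
    let W : Hilb (Site d) q →L[ℂ] Hilb (Site d) q :=
      (shiftUnitary x).symm.toContinuousLinearEquiv.toContinuousLinearMap
    have h : ∀ T : Hilb (Site d) q →L[ℂ] Hilb (Site d) q, shiftOp x T = (U.comp T).comp W :=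
      fun T => by ext ψ : 1; rfl
    simp_rw [h]
    fun_prop
  refine map_mem_closure hc T.2 ?_
  rintro _ ⟨X, -, A, rfl⟩
  exact ⟨_, by simp, _, (shiftOp_embed x X A).symm⟩

/-- The translation automorphism `τ_x` of the quasi-local algebra. -/
noncomputable def translate {d q : ℕ} (x : Site d) (T : QuasiLocal (Site d) q) :
    QuasiLocal (Site d) q :=
  ⟨shiftOp x T, shiftOp_mem x T⟩

/-! ### States -/

/-- The quantum states of the spin lattice: positive linear functionals on the quasi-local algebra
with `ρ(𝕀) = 1`. -/
structure State (V : Type*) [DecidableEq V] (q : ℕ) where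
  toLinearMap : QuasiLocal V q →ₗ[ℂ] ℂ
  nonneg' : ∀ A : QuasiLocal V q, 0 ≤ toLinearMap (star A * A)
  map_one' : toLinearMap 1 = 1

/-- Two states have the same marginal on the region `Γ`, i.e. the same restriction to `𝔘_Γ`. -/
def State.EqOn {V : Type*} [DecidableEq V] {q : ℕ} (ρ σ : State V q) (Γ : Set V) : Prop :=
  ∀ A : QuasiLocal V q, (A : Hilb V q →L[ℂ] Hilb V q) ∈ regionAlgebra q Γ →
    ρ.toLinearMap A = σ.toLinearMap A

/-- The marginal `ρ_Λ` on a finite region as a density matrix, i.e. the matrix with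
`ρ(A) = Tr[ρ_Λ A]` for every operator `A` on `Λ`. -/
noncomputable def State.marginal {V : Type*} [DecidableEq V] {q : ℕ} (ρ : State V q)
    (Λ : Finset V) : FinOp Λ q :=
  Matrix.of fun η ζ => ρ.toLinearMap (toQuasiLocal Λ (Matrix.single ζ η 1))

theorem State.trace_marginal_mul {V : Type*} [DecidableEq V] {q : ℕ} (ρ : State V q)
    (Λ : Finset V) (A : FinOp Λ q) :
    (ρ.marginal Λ * A).trace = ρ.toLinearMap (toQuasiLocal Λ A) := by
  let L : FinOp Λ q →ₗ[ℂ] ℂ :=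
    { toFun := fun A => ρ.toLinearMap (toQuasiLocal Λ A)
      map_add' := fun A B => by
        rw [← map_add]; congr 1; exact Subtype.ext (map_add (embed Λ) A B)
      map_smul' := fun c A => by
        rw [RingHom.id_apply, ← map_smul]; congr 1; exact Subtype.ext (map_smul (embed Λ) c A) }
  change _ = L A
  conv_rhs => rw [Matrix.matrix_eq_sum_single A]
  simp only [map_sum, Matrix.trace, Matrix.diag, Matrix.mul_apply]
  rw [Finset.sum_comm]
  refine Finset.sum_congr rfl fun ζ _ => Finset.sum_congr rfl fun η _ => ?_
  have : Matrix.single ζ η (A ζ η) = A ζ η • Matrix.single ζ η (1 : ℂ) := by simp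
  rw [this, map_smul, smul_eq_mul, mul_comm]
  rfl

/-- The translated state, `(τ_x ρ)(A) = ρ(τ_{-x} A)`, equivalently `(τ_x ρ)(τ_x A) = ρ(A)`. -/
noncomputable def State.translate {d q : ℕ} (x : Site d) (ρ : State (Site d) q) :
    State (Site d) q where
  toLinearMap :=
    { toFun := fun A => ρ.toLinearMap (SpinLattice.translate (-x) A)
      map_add' := fun A B => by
        rw [← map_add]; exact congrArg _ (Subtype.ext (map_add (shiftOp (-x)) _ _))
      map_smul' := fun c A => by
        rw [RingHom.id_apply, ← map_smul]
        exact congrArg _ (Subtype.ext (map_smul (shiftOp (-x)) c _)) }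
  nonneg' A := by
    have : SpinLattice.translate (-x) (star A * A) =
        star (SpinLattice.translate (-x) A) * SpinLattice.translate (-x) A := by
      apply Subtype.ext
      change shiftOp (-x) (star A.1 * A.1) =
        star (shiftOp (-x) A.1) * shiftOp (-x) A.1
      rw [map_mul, map_star]
    change 0 ≤ ρ.toLinearMap (SpinLattice.translate (-x) (star A * A))
    rw [this]
    exact ρ.nonneg' _
  map_one' := by
    have : SpinLattice.translate (-x) (1 : QuasiLocal (Site d) q) = 1 :=
      Subtype.ext (map_one (shiftOp (-x)))
    change ρ.toLinearMap (SpinLattice.translate (-x) 1) = 1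
    rw [this, ρ.map_one']

/-- Translation-invariant states. -/
def State.IsTranslationInvariant {d q : ℕ} (ρ : State (Site d) q) : Prop :=
  ∀ x : Site d, ρ.translate x = ρ

/-! ### The specific quantum `W₁` distance -/

/-- The box `Λ_a = {x ∈ ℤ^d : -a_i ≤ x_i < a_i for every i}`. -/
noncomputable def box {d : ℕ} (a : Fin d → ℕ+) : Finset (Site d) :=
  Fintype.piFinset fun i => Finset.Ico (-((a i : ℕ) : ℤ)) ((a i : ℕ) : ℤ)

/-- The `W₁` distance per site between the marginals on the box `Λ_a`. -/
noncomputable def w1Box {d q : ℕ} (ρ σ : State (Site d) q) (a : Fin d → ℕ+) : ℝ :=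
  W1Norm (ρ.marginal (box a) - σ.marginal (box a)) / ((box a).card : ℝ)

/-- The specific quantum `W₁` distance, the limit of the `W₁` distance per site as all the sides of
the box go to infinity. -/
noncomputable def w1 {d q : ℕ} (ρ σ : State (Site d) q) : ℝ :=
  Filter.limUnder Filter.atTop (w1Box ρ σ)

/-- The numbers `c ≥ 0` for which there are states `ρ'`, `σ'` with the same marginal away from the
origin such that `ρ_Λ - σ_Λ = c ∑_{x ∈ Λ} ((τ_x ρ')_Λ - (τ_x σ')_Λ)` for every finite `Λ`. -/
def w1NormSet {d q : ℕ} (ρ σ : State (Site d) q) : Set ℝ :=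
  {c | 0 ≤ c ∧ ∃ ρ' σ' : State (Site d) q, ρ'.EqOn σ' {0}ᶜ ∧
    ∀ Λ : Finset (Site d), ρ.marginal Λ - σ.marginal Λ =
      (c : ℂ) • ∑ x ∈ Λ, ((ρ'.translate x).marginal Λ - (σ'.translate x).marginal Λ)}

/-- The quantity `‖ρ - σ‖_{w₁}`, the infimum of the admissible constants. -/
noncomputable def w1Norm {d q : ℕ} (ρ σ : State (Site d) q) : ℝ :=
  sInf (w1NormSet ρ σ)

end SpinLattice

/-! The limit exists because two one-sided bounds meet at the infimum of the admissible constants;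
no subadditivity is needed.

One bound holds in every box (`w1Box_le_of_mem_w1NormSet`): for an admissible `c`, the terms `c
((τ_x ρ')_Λ - (τ_x σ')_Λ)` are themselves a decomposition of the kind that defines the `W₁` norm, of
cost at most `c |Λ|`.

The other is a compactness argument (`exists_mem_w1NormSet_le`). Suppose the distance per site is
below `b` in arbitrarily large boxes `B`. Split each term of a near-optimal decomposition `ρ_B - σ_B
= ∑ D_x` into its Jordan parts `P_x - N_x`, extend them by a fixed configuration outside `B`, bring
`x` to the origin and average over `x ∈ B`. This gives two positive functionals of equal mass at
most `b` that agree away from the origin (`exists_functionals_of_w1Box_lt`). Summing the translates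
of their difference over the sites of `Λ` reassembles `∑ D_x` (`sum_avgFunctional_translate`), and
translation invariance turns the result into `ρ(A) - σ(A)` up to a boundary term that vanishes in
the limit (`tendsto_sum_trace_compress`). Limits along an ultrafilter, once normalised, are the
required `ρ'` and `σ'`. -/

namespace SpinLattice

/-! ### Trace norm and positive matrices. -/

section Matrix

variable {n : Type*} [Fintype n] [DecidableEq n]

theorem trace_mul_nonneg {P Q : Matrix n n ℂ} (hP : P.PosSemidef) (hQ : Q.PosSemidef) :
    0 ≤ (P * Q).trace := by
  obtain ⟨C, rfl⟩ := CStarAlgebra.nonneg_iff_eq_star_mul_self.mp hQ.nonneg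
  rw [← mul_assoc, Matrix.trace_mul_comm, ← mul_assoc]
  exact (hP.mul_mul_conjTranspose_same C).trace_nonneg

theorem traceNorm_nonneg (A : Matrix n n ℂ) : 0 ≤ traceNorm A := by
  have : (CFC.sqrt (A.conjTranspose * A)).PosSemidef :=
    Matrix.nonneg_iff_posSemidef.mp (CFC.sqrt_nonneg _)
  exact (Complex.le_def.mp this.trace_nonneg).1

/-- The Jordan decomposition of a self-adjoint operator computes its trace norm. -/
theorem exists_posSemidef_sub_eq {D : Matrix n n ℂ} (hD : D.IsHermitian) :
    ∃ P N : Matrix n n ℂ, P.PosSemidef ∧ N.PosSemidef ∧ P - N = D ∧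
      (traceNorm D : ℂ) = P.trace + N.trace := by
  have hD' : IsSelfAdjoint D := hD
  have hP := Matrix.nonneg_iff_posSemidef.mp (CFC.posPart_nonneg D)
  have hN := Matrix.nonneg_iff_posSemidef.mp (CFC.negPart_nonneg D)
  refine ⟨D⁺, D⁻, hP, hN, CFC.posPart_sub_negPart D hD', ?_⟩
  have h : traceNorm D = (D⁺ + D⁻).trace.re := by
    rw [CFC.posPart_add_negPart D hD']; rfl
  rw [h, ← Matrix.trace_add]
  exact Complex.ext rfl (Complex.nonneg_iff.mp (hP.add hN).trace_nonneg).2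

/-- With `Q` the sign of `D = A - B` one has `|D| = Q D` and `-1 ≤ Q ≤ 1`, so `Tr |D| = Tr QA - Tr
QB ≤ Tr A + Tr B`. Every cost estimate below goes through this bound. -/
theorem traceNorm_sub_le {A B : Matrix n n ℂ} (hA : A.PosSemidef) (hB : B.PosSemidef) :
    traceNorm (A - B) ≤ (A.trace + B.trace).re := by
  set D := A - B with hDdef
  have hD : IsSelfAdjoint D := (hA.isHermitian.sub hB.isHermitian)
  have hc (f : ℝ → ℝ) : ContinuousOn f (spectrum ℝ D) :=
    (Matrix.finite_real_spectrum (A := D)).continuousOn f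
  set Q := cfc (fun t : ℝ => if 0 ≤ t then (1 : ℝ) else -1) D with hQ
  have habs : CFC.abs D = Q * D := by
    have hid : Q * D = Q * cfc (fun t : ℝ => t) D := by rw [cfc_id' ℝ D hD]
    rw [CFC.abs_eq_cfc_norm D hD, hid, hQ, ← cfc_mul _ _ D (hc _) (hc _)]
    refine cfc_congr fun t _ => ?_
    by_cases h : 0 ≤ t
    · simp [h, abs_of_nonneg h]
    · simp [h, abs_of_neg (not_le.mp h)]
  have h1 : (1 - Q).PosSemidef := by
    rw [← Matrix.nonneg_iff_posSemidef, ← cfc_one ℝ D hD, hQ, ← cfc_sub _ _ D (hc _) (hc _)]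
    refine cfc_nonneg fun t _ => ?_
    split_ifs <;> simp
  have h2 : (1 + Q).PosSemidef := by
    rw [← Matrix.nonneg_iff_posSemidef, ← cfc_one ℝ D hD, hQ, ← cfc_add D _ _ (hc _) (hc _)]
    refine cfc_nonneg fun t _ => ?_
    split_ifs <;> simp
  have h3 := (Complex.nonneg_iff.mp (trace_mul_nonneg h1 hA)).1
  have h4 := (Complex.nonneg_iff.mp (trace_mul_nonneg h2 hB)).1
  have h5 : traceNorm D = (Q * D).trace.re := by rw [← habs]; rfl
  rw [h5, hDdef, mul_sub, Matrix.trace_sub]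
  simp only [sub_mul, add_mul, one_mul, Matrix.trace_sub, Matrix.trace_add, Complex.sub_re,
    Complex.add_re] at h3 h4 ⊢
  linarith

end Matrix

/-- A positive functional on a C⋆-algebra is bounded in terms of its value at the unit. -/
theorem norm_apply_le_of_positive {A : Type*} [CStarAlgebra A] (L : A →ₗ[ℂ] ℂ)
    (hL : ∀ a, 0 ≤ L (star a * a)) (a : A) : ‖L a‖ ≤ 4 * ‖L 1‖ * ‖a‖ := by
  let _ := CStarAlgebra.spectralOrder A
  have := CStarAlgebra.spectralOrderedRing A
  have h0 : ∀ b : A, 0 ≤ b → 0 ≤ L b := fun b hb => by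
    obtain ⟨c, rfl⟩ := CStarAlgebra.nonneg_iff_eq_star_mul_self.mp hb
    exact hL c
  let f : A →ₚ[ℂ] ℂ := .mk₀ L h0
  have h1 : ∀ b : A, 0 ≤ b → ‖b‖ ≤ ‖a‖ → ‖L b‖ ≤ ‖L 1‖ * ‖a‖ := fun b hb hba =>
    (f.norm_apply_le_of_nonneg b hb).trans (mul_le_mul_of_nonneg_left hba (norm_nonneg _))
  -- The factor 4 counts the positive elements into which `a` splits. It is not sharp, but only a
  -- bound uniform in the functional is needed.
  obtain ⟨y, hy0, hy1, hy⟩ := CStarAlgebra.exists_sum_four_nonneg a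
  conv_lhs => rw [hy]
  simp only [map_sum, map_smul]
  refine (norm_sum_le _ _).trans ?_
  refine (Finset.sum_le_sum (g := fun _ => ‖L 1‖ * ‖a‖) fun i _ => ?_).trans
    (le_of_eq (by simp [mul_assoc]))
  simpa using h1 _ (hy0 i) (hy1 i)

/-! ### Partial traces and operators acting trivially at a site. -/

section PartialTrace

variable {ι : Type*} [DecidableEq ι] {q : ℕ}

theorem partialTrace_sub (x : ι) (A B : FinOp ι q) :
    partialTrace x (A - B) = partialTrace x A - partialTrace x B := by
  ext η ζ; simp [partialTrace]

theorem partialTrace_smul (x : ι) (c : ℂ) (A : FinOp ι q) :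
    partialTrace x (c • A) = c • partialTrace x A := by
  ext η ζ; simp [partialTrace, Finset.mul_sum]

@[simp] theorem insertSite_self (x : ι) (s : Fin q) (η : {y : ι // y ≠ x} → Fin q) :
    insertSite x s η x = s := by simp [insertSite]

theorem insertSite_eq_iff {x : ι} {s : Fin q} {η : {y : ι // y ≠ x} → Fin q} {ω : ι → Fin q} :
    insertSite x s η = ω ↔ s = ω x ∧ η = fun y : {y : ι // y ≠ x} => ω y := by
  constructor
  · rintro rfl
    exact ⟨by simp, funext fun y => by simp [insertSite, y.2]⟩
  · rintro ⟨rfl, rfl⟩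
    funext y
    by_cases h : y = x
    · subst h; simp
    · simp [insertSite, h]

variable [Fintype ι]

theorem sum_config_eq_sum_insertSite {M : Type*} [AddCommMonoid M] (x : ι)
    (f : (ι → Fin q) → M) : ∑ η, f η = ∑ s, ∑ η, f (insertSite x s η) := by
  rw [← Fintype.sum_prod_type', ← (Equiv.funSplitAt x (Fin q)).symm.sum_comp]
  refine Finset.sum_congr rfl fun p _ => congrArg f (funext fun y => ?_)
  by_cases h : y = x <;> simp [insertSite, h]

theorem trace_partialTrace (x : ι) (A : FinOp ι q) : (partialTrace x A).trace = A.trace := by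
  simp only [Matrix.trace, Matrix.diag, partialTrace, Matrix.of_apply]
  rw [Finset.sum_comm, sum_config_eq_sum_insertSite x]

/-- Tracing against an operator which acts trivially at `x` only depends on the partial trace
over `x`. -/
theorem trace_mul_eq_zero_of_partialTrace_eq_zero {x : ι} {D M : FinOp ι q}
    (hD : partialTrace x D = 0)
    (h₁ : ∀ η ζ, η x ≠ ζ x → M η ζ = 0)
    (h₂ : ∀ s t η ζ, M (insertSite x s η) (insertSite x s ζ) =
      M (insertSite x t η) (insertSite x t ζ)) : (D * M).trace = 0 := by
  -- For `q = 0` there are no configurations, since the site `x` exists. Otherwise `s₀` serves as a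
  -- reference value at `x` that makes the entries of `M` independent of `s`.
  rcases isEmpty_or_nonempty (Fin q) with hq | ⟨⟨s₀⟩⟩
  · have : IsEmpty (ι → Fin q) := ⟨fun f => hq.elim (f x)⟩
    simp [Matrix.trace]
  simp only [Matrix.trace, Matrix.diag, Matrix.mul_apply]
  rw [sum_config_eq_sum_insertSite x]
  have h : ∀ s η, ∑ ζ, D (insertSite x s η) ζ * M ζ (insertSite x s η) =
      ∑ ζ, D (insertSite x s η) (insertSite x s ζ) *
        M (insertSite x s₀ ζ) (insertSite x s₀ η) := by
    intro s η
    rw [sum_config_eq_sum_insertSite x, Finset.sum_eq_single s]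
    · exact Finset.sum_congr rfl fun ζ _ => by rw [h₂ s s₀]
    · intro t _ ht
      exact Finset.sum_eq_zero fun ζ _ => by rw [h₁ _ _ (by simpa using ht), mul_zero]
    · simp
  simp_rw [h]
  rw [Finset.sum_comm]
  refine Finset.sum_eq_zero fun η _ => ?_
  rw [Finset.sum_comm]
  refine Finset.sum_eq_zero fun ζ _ => ?_
  rw [← Finset.sum_mul]
  have := congrFun (congrFun hD η) ζ
  simp only [partialTrace, Matrix.of_apply, Matrix.zero_apply] at this
  rw [this, zero_mul]

end PartialTrace

/-! ### Marginals of states as density matrices. -/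

section Marginal

variable {V : Type*} [DecidableEq V] {q : ℕ}

theorem toQuasiLocal_mul (Λ : Finset V) (A B : FinOp Λ q) :
    toQuasiLocal Λ (A * B) = toQuasiLocal Λ A * toQuasiLocal Λ B :=
  Subtype.ext (map_mul (embed Λ) A B)

theorem toQuasiLocal_star (Λ : Finset V) (A : FinOp Λ q) :
    toQuasiLocal Λ (star A) = star (toQuasiLocal Λ A) :=
  Subtype.ext (map_star (embed Λ) A)

theorem toQuasiLocal_one (Λ : Finset V) : toQuasiLocal Λ (1 : FinOp Λ q) = 1 :=
  Subtype.ext (map_one (embed Λ))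

theorem toQuasiLocal_extendOp {X Y : Finset V} (h : X ⊆ Y) (A : FinOp X q) :
    toQuasiLocal Y (extendOp h A) = toQuasiLocal X A :=
  Subtype.ext (embed_extendOp h A)

theorem State.trace_marginal (ρ : State V q) (Λ : Finset V) : (ρ.marginal Λ).trace = 1 := by
  have := ρ.trace_marginal_mul Λ 1
  rwa [mul_one, toQuasiLocal_one, ρ.map_one'] at this

theorem State.posSemidef_marginal (ρ : State V q) (Λ : Finset V) :
    (ρ.marginal Λ).PosSemidef := by
  have h : ∀ v : (Λ → Fin q) → ℂ, 0 ≤ star v ⬝ᵥ (ρ.marginal Λ).mulVec v := by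
    intro v
    obtain ⟨C, hC⟩ := CStarAlgebra.nonneg_iff_eq_star_mul_self.mp
      (Matrix.posSemidef_vecMulVec_self_star v).nonneg
    have h1 : star v ⬝ᵥ (ρ.marginal Λ).mulVec v =
        (ρ.marginal Λ * Matrix.vecMulVec v (star v)).trace := by
      rw [Matrix.mul_vecMulVec, Matrix.trace_vecMulVec, dotProduct_comm]
    rw [h1, hC, ρ.trace_marginal_mul, toQuasiLocal_mul, toQuasiLocal_star]
    exact ρ.nonneg' _
  -- Over `ℂ` a real quadratic form already forces the matrix to be Hermitian.
  refine .of_dotProduct_mulVec_nonneg (Matrix.isSymmetric_toEuclideanLin_iff.mp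
    ((LinearMap.isSymmetric_iff_inner_map_self_real _).mpr fun v => ?_)) h
  have h2 : inner ℂ (Matrix.toEuclideanLin (ρ.marginal Λ) v) v =
      star (star v.ofLp ⬝ᵥ (ρ.marginal Λ).mulVec v.ofLp) := by
    rw [← inner_conj_symm]
    simp [EuclideanSpace.inner_eq_star_dotProduct, dotProduct_comm]
  rw [h2]
  have h3 := (Complex.nonneg_iff.mp (h v.ofLp)).2
  apply Complex.ext <;> simp [← h3]

theorem State.partialTrace_marginal_eq {ρ σ : State V q} {Λ : Finset V} (x : Λ)
    (h : ρ.EqOn σ {x.1}ᶜ) :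
    partialTrace x (ρ.marginal Λ) = partialTrace x (σ.marginal Λ) := by
  -- An entry of the partial trace is the value of the state on a matrix unit of `Λ \ {x}`:
  -- tensoring that unit with the identity at `x` produces the sum over `s`. Such operators lie in
  -- the algebra of the complement of `x`.
  have key : ∀ (τ : State V q) (η ζ : {y : Λ // y ≠ x} → Fin q),
      partialTrace x (τ.marginal Λ) η ζ = τ.toLinearMap (toQuasiLocal (Λ.erase x.1)
        (Matrix.single (fun v => ζ ⟨⟨v.1, Finset.mem_of_mem_erase v.2⟩, fun h =>
          Finset.ne_of_mem_erase v.2 (congrArg Subtype.val h)⟩)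
          (fun v => η ⟨⟨v.1, Finset.mem_of_mem_erase v.2⟩, fun h =>
          Finset.ne_of_mem_erase v.2 (congrArg Subtype.val h)⟩) 1)) := by
    intro τ η ζ
    rw [← toQuasiLocal_extendOp (Finset.erase_subset x.1 Λ), ← τ.trace_marginal_mul]
    have hs : extendOp (Finset.erase_subset x.1 Λ) (Matrix.single
          (fun v => ζ ⟨⟨v.1, Finset.mem_of_mem_erase v.2⟩, fun h =>
          Finset.ne_of_mem_erase v.2 (congrArg Subtype.val h)⟩)
          (fun v => η ⟨⟨v.1, Finset.mem_of_mem_erase v.2⟩, fun h =>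
          Finset.ne_of_mem_erase v.2 (congrArg Subtype.val h)⟩) 1) =
        ∑ s, Matrix.single (insertSite x s ζ) (insertSite x s η) (1 : ℂ) := by
      ext a b
      simp only [extendOp, Matrix.of_apply, Matrix.sum_apply, Matrix.single_apply,
        insertSite_eq_iff]
      have e1 : (∀ v : Λ, v.1 ∉ Λ.erase x.1 → a v = b v) ↔ a x = b x := by
        refine ⟨fun h => h x (Finset.notMem_erase _ _), fun h v hv => ?_⟩
        have : v = x := by
          by_contra hne
          exact hv (Finset.mem_erase.mpr ⟨fun h => hne (Subtype.ext h), v.2⟩)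
        rw [this, h]
      have e2 : ∀ (θ : {y : Λ // y ≠ x} → Fin q) (c : Λ → Fin q),
          ((fun v : (Λ.erase x.1 : Finset V) => θ ⟨⟨v.1, Finset.mem_of_mem_erase v.2⟩, fun h =>
            Finset.ne_of_mem_erase v.2 (congrArg Subtype.val h)⟩) =
            fun v => c ⟨v.1, Finset.mem_of_mem_erase v.2⟩) ↔
          θ = fun y : {y : Λ // y ≠ x} => c y := by
        intro θ c
        constructor
        · intro h
          funext y
          exact congrFun h ⟨y.1.1, Finset.mem_erase.mpr
            ⟨fun h => y.2 (Subtype.ext h), y.1.2⟩⟩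
        · rintro rfl
          rfl
      simp only [e1, e2]
      by_cases h1 : ζ = fun y : {y : Λ // y ≠ x} => a y
      · by_cases h2 : η = fun y : {y : Λ // y ≠ x} => b y
        · by_cases h : a x = b x
          · simp only [h1.symm, h2.symm, h, and_true, if_true, and_self]
            simp
          · simp only [h1.symm, h2.symm, h, and_true, if_false]
            refine (Finset.sum_eq_zero fun s _ => if_neg ?_).symm
            rintro ⟨rfl, h'⟩
            exact h h'
        · simp only [h2, and_false, if_false, Finset.sum_const_zero, ite_self]
      · simp only [h1, false_and, and_false, if_false, Finset.sum_const_zero, ite_self]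
    rw [hs, Finset.mul_sum, Matrix.trace_sum]
    simp [partialTrace, Matrix.trace_mul_single]
  ext η ζ
  rw [key, key]
  refine h _ (StarSubalgebra.le_topologicalClosure _ ⟨_, ?_, _, rfl⟩)
  simp

end Marginal

/-! ### Existence of `W₁` decompositions by resetting sites one at a time. -/

section Decomposition

variable {ι : Type*} [DecidableEq ι] {q : ℕ} [NeZero q]

/-- The operator `|0⟩⟨0|_x ⊗ Tr_x A`: the site `x` is reset to the basis vector `0`. -/
def resetSite (x : ι) (A : FinOp ι q) : FinOp ι q :=
  Matrix.of fun η ζ => if η x = 0 ∧ ζ x = 0 then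
    ∑ s, A (Function.update η x s) (Function.update ζ x s) else 0

theorem partialTrace_resetSite (x : ι) (A : FinOp ι q) :
    partialTrace x (resetSite x A) = partialTrace x A := by
  have h : ∀ (s t : Fin q) (η : {y : ι // y ≠ x} → Fin q),
      Function.update (insertSite x t η) x s = insertSite x s η := by
    intro s t η
    funext y
    by_cases hy : y = x
    · subst hy; simp
    · simp [insertSite, hy]
  ext η ζ
  simp [partialTrace, resetSite, h]

variable [Fintype ι]

theorem trace_resetSite (x : ι) (A : FinOp ι q) : (resetSite x A).trace = A.trace := by
  rw [← trace_partialTrace x, partialTrace_resetSite, trace_partialTrace]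

/-- Resetting is a sum of compressions of submatrices of `A`, in Kraus form. -/
theorem posSemidef_resetSite (x : ι) {A : FinOp ι q} (hA : A.PosSemidef) :
    (resetSite x A).PosSemidef := by
  let m : (ι → Fin q) → ℂ := fun η => if η x = 0 then 1 else 0
  have h : resetSite x A = ∑ s : Fin q, Matrix.diagonal m *
      A.submatrix (fun η => Function.update η x s) (fun η => Function.update η x s) *
      (Matrix.diagonal m).conjTranspose := by
    ext η ζ
    rw [Matrix.sum_apply]
    simp only [resetSite, Matrix.of_apply, Matrix.diagonal_conjTranspose,
      Matrix.mul_diagonal, Matrix.diagonal_mul, Matrix.submatrix_apply, m]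
    by_cases h1 : η x = 0 <;> by_cases h2 : ζ x = 0 <;> simp [h1, h2]
  rw [h]
  exact Matrix.posSemidef_sum _ fun s _ => (hA.submatrix _).mul_mul_conjTranspose_same _

/-- Resetting one more site `y` changes `P' - N'` by an operator whose partial trace over `y`
vanishes; these increments are the `D x`. The last clause records that what remains is supported on
configurations vanishing on `S`. -/
theorem exists_telescoping {P N : FinOp ι q} (hP : P.PosSemidef) (hN : N.PosSemidef)
    (hP1 : P.trace = 1) (hN1 : N.trace = 1) (S : Finset ι) :
    ∃ (D : ι → FinOp ι q) (P' N' : FinOp ι q),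
      (∀ x, (D x).IsHermitian ∧ (D x).trace = 0 ∧ partialTrace x (D x) = 0) ∧
      (∀ x, traceNorm (D x) ≤ 4) ∧ ∑ x ∈ S, D x + (P' - N') = P - N ∧
      P'.PosSemidef ∧ N'.PosSemidef ∧ P'.trace = 1 ∧ N'.trace = 1 ∧
      ∀ x ∈ S, ∀ η ζ : ι → Fin q, (η x ≠ 0 ∨ ζ x ≠ 0) → P' η ζ = 0 ∧ N' η ζ = 0 := by
  induction S using Finset.induction_on with
  | empty =>
    refine ⟨fun _ => 0, P, N, fun x => ?_, fun x => ?_, by simp, hP, hN, hP1, hN1, by simp⟩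
    · refine ⟨Matrix.isHermitian_zero, by simp, by ext; simp [partialTrace]⟩
    · have := traceNorm_sub_le (n := ι → Fin q) Matrix.PosSemidef.zero Matrix.PosSemidef.zero
      simp only [sub_self, Matrix.trace_zero, add_zero, Complex.zero_re] at this
      linarith
  | insert y S hy ih =>
    obtain ⟨D, P', N', hD, hD4, hsum, hP', hN', hP1', hN1', hz⟩ := ih
    -- Regrouped as a difference of two positive operators of trace 2, whence the bound 4.
    have hE : P' - resetSite y P' - (N' - resetSite y N') =
        (P' + resetSite y N') - (N' + resetSite y P') := by abel
    have pA := hP'.add (posSemidef_resetSite y hN')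
    have pB := hN'.add (posSemidef_resetSite y hP')
    refine ⟨Function.update D y (P' - resetSite y P' - (N' - resetSite y N')),
      resetSite y P', resetSite y N', fun x => ?_, fun x => ?_, ?_,
      posSemidef_resetSite y hP', posSemidef_resetSite y hN',
      (trace_resetSite y P').trans hP1', (trace_resetSite y N').trans hN1', ?_⟩
    · rcases eq_or_ne x y with rfl | hxy
      · rw [Function.update_self]
        refine ⟨?_, ?_, ?_⟩
        · rw [hE]; exact pA.isHermitian.sub pB.isHermitian
        · simp [trace_resetSite]
        · simp [partialTrace_sub, partialTrace_resetSite]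
      · rw [Function.update_of_ne hxy]; exact hD x
    · rcases eq_or_ne x y with rfl | hxy
      · rw [Function.update_self, hE]
        refine (traceNorm_sub_le pA pB).trans ?_
        simp only [Matrix.trace_add, trace_resetSite, hP1', hN1']
        norm_num
      · rw [Function.update_of_ne hxy]; exact hD4 x
    · rw [Finset.sum_insert hy, Function.update_self, ← hsum,
        Finset.sum_congr rfl fun x hx => Function.update_of_ne (ne_of_mem_of_not_mem hx hy) _ _]
      abel
    · intro x hx η ζ h
      rcases eq_or_ne x y with rfl | hxy
      · have : ¬ (η x = 0 ∧ ζ x = 0) := by tauto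
        simp [resetSite, this]
      · have hx' := Finset.mem_of_mem_insert_of_ne hx hxy
        have h0 : ∀ s, P' (Function.update η y s) (Function.update ζ y s) = 0 ∧
            N' (Function.update η y s) (Function.update ζ y s) = 0 := fun s =>
          hz x hx' _ _ (by simpa [Function.update_of_ne hxy] using h)
        simp [resetSite, h0]

/-- The difference of two density matrices admits a decomposition as in the definition of the `W₁`
norm. -/
theorem exists_decomposition {P N : FinOp ι q} (hP : P.PosSemidef) (hN : N.PosSemidef)
    (hP1 : P.trace = 1) (hN1 : N.trace = 1) :
    ∃ D : ι → FinOp ι q,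
      (∀ x, (D x).IsHermitian ∧ (D x).trace = 0 ∧ partialTrace x (D x) = 0) ∧
      ∑ x, D x = P - N ∧ ∑ x, traceNorm (D x) ≤ 4 * Fintype.card ι := by
  obtain ⟨D, P', N', hD, hD4, hsum, -, -, hP1', hN1', hz⟩ :=
    exists_telescoping hP hN hP1 hN1 Finset.univ
  refine ⟨D, hD, ?_, ?_⟩
  · have h0 : ∀ η ζ : ι → Fin q, η ≠ 0 ∨ ζ ≠ 0 → P' η ζ = 0 ∧ N' η ζ = 0 := by
      rintro η ζ (h | h)
      · obtain ⟨x, hx⟩ := Function.ne_iff.mp h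
        exact hz x (Finset.mem_univ x) η ζ (Or.inl hx)
      · obtain ⟨x, hx⟩ := Function.ne_iff.mp h
        exact hz x (Finset.mem_univ x) η ζ (Or.inr hx)
    -- With every site reset, both operators are supported on the single configuration 0 and have
    -- trace 1.
    have e : P' = N' := by
      ext η ζ
      by_cases h : η ≠ 0 ∨ ζ ≠ 0
      · rw [(h0 η ζ h).1, (h0 η ζ h).2]
      · push Not at h
        obtain ⟨rfl, rfl⟩ := h
        have hP2 : P'.trace = P' 0 0 := Finset.sum_eq_single 0
          (fun η _ h => (h0 η η (Or.inl h)).1) (by simp)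
        have hN2 : N'.trace = N' 0 0 := Finset.sum_eq_single 0
          (fun η _ h => (h0 η η (Or.inl h)).2) (by simp)
        rw [← hP2, ← hN2, hP1', hN1']
    rw [← hsum, e]; simp
  · refine (Finset.sum_le_sum fun x _ => hD4 x).trans (le_of_eq ?_)
    simp [mul_comm]

end Decomposition

/-! ### Upper bounds and near-minimisers for the `W₁` norm. -/

section W1Norm

variable {ι : Type*} [Fintype ι] [DecidableEq ι] {q : ℕ}

theorem W1Norm_le {Δ : FinOp ι q} {D : ι → FinOp ι q}
    (hD : ∀ x, (D x).IsHermitian ∧ (D x).trace = 0 ∧ partialTrace x (D x) = 0)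
    (hsum : ∑ x, D x = Δ) : W1Norm Δ ≤ 1 / 2 * ∑ x, traceNorm (D x) := by
  refine mul_le_mul_of_nonneg_left (csInf_le ⟨0, ?_⟩ ⟨D, hD, hsum, rfl⟩) (by norm_num)
  rintro _ ⟨D', -, -, rfl⟩
  exact Finset.sum_nonneg fun x _ => traceNorm_nonneg _

theorem exists_decomposition_lt [NeZero q] {P N : FinOp ι q} (hP : P.PosSemidef)
    (hN : N.PosSemidef) (hP1 : P.trace = 1) (hN1 : N.trace = 1) {b : ℝ} (hb : W1Norm (P - N) < b) :
    ∃ D : ι → FinOp ι q,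
      (∀ x, (D x).IsHermitian ∧ (D x).trace = 0 ∧ partialTrace x (D x) = 0) ∧
      ∑ x, D x = P - N ∧ ∑ x, traceNorm (D x) < 2 * b := by
  have hb' : sInf {r : ℝ | ∃ D : ι → FinOp ι q,
      (∀ x, (D x).IsHermitian ∧ (D x).trace = 0 ∧ partialTrace x (D x) = 0) ∧
      ∑ x, D x = P - N ∧ r = ∑ x, traceNorm (D x)} < 2 * b := by
    unfold W1Norm at hb; linarith
  -- Nonemptiness makes the infimum genuine: `sInf ∅` would be 0.
  obtain ⟨D, hD, hsum, -⟩ := exists_decomposition hP hN hP1 hN1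
  obtain ⟨_, ⟨D', hD', hsum', rfl⟩, hlt⟩ := exists_lt_of_csInf_lt
    (by exact ⟨_, D, hD, hsum, rfl⟩) hb'
  exact ⟨D', hD', hsum', hlt⟩

end W1Norm

/-! ### Extending functionals on a finite region by a fixed outer configuration. -/

section Compress

variable {V : Type*} {q : ℕ}

open Classical in
/-- The canonical basis vector of a configuration. -/
noncomputable def basisVec (ω : V → Fin q) : Hilb V q := lp.single 2 ω (1 : ℂ)

theorem inner_basisVec_left (ω : V → Fin q) (ψ : Hilb V q) : inner ℂ (basisVec ω) ψ = ψ ω := by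
  classical
  simp [basisVec, lp.inner_single_left]

open Classical in
theorem basisVec_apply (ω ω' : V → Fin q) : basisVec ω ω' = if ω' = ω then 1 else 0 := by
  simp [basisVec, lp.single_apply, Pi.single_apply]

variable [DecidableEq V]

/-- The compression of a bounded operator to the configurations which agree with `ω₀` outside
`Λ`. -/
noncomputable def compress (ω₀ : V → Fin q) (Λ : Finset V) :
    (Hilb V q →L[ℂ] Hilb V q) →ₗ[ℂ] FinOp Λ q where
  toFun T := Matrix.of fun ζ η => T (basisVec (overwrite Λ η ω₀)) (overwrite Λ ζ ω₀)
  map_add' S T := by ext; simp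
  map_smul' c T := by ext; simp

theorem compress_apply (ω₀ : V → Fin q) (Λ : Finset V) (T : Hilb V q →L[ℂ] Hilb V q)
    (ζ η : Λ → Fin q) :
    compress ω₀ Λ T ζ η = T (basisVec (overwrite Λ η ω₀)) (overwrite Λ ζ ω₀) := rfl

theorem continuous_compress (ω₀ : V → Fin q) (Λ : Finset V) :
    Continuous (compress ω₀ Λ) := by
  refine continuous_matrix fun ζ η => ?_
  simp only [compress_apply, ← inner_basisVec_left]
  fun_prop

/-- The entries are inner products of the vectors `S e_η`, hence a Gram matrix. -/
theorem posSemidef_compress (ω₀ : V → Fin q) (Λ : Finset V) (S : Hilb V q →L[ℂ] Hilb V q) :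
    (compress ω₀ Λ (star S * S)).PosSemidef := by
  have : compress ω₀ Λ (star S * S) =
      Matrix.gram ℂ fun η => S (basisVec (overwrite Λ η ω₀)) := by
    ext ζ η
    rw [compress_apply, ← inner_basisVec_left, Matrix.gram_apply,
      ContinuousLinearMap.star_eq_adjoint, mul_apply_eq_comp,
      ContinuousLinearMap.adjoint_inner_right]
  rw [this]
  exact Matrix.posSemidef_gram _ _

theorem overwrite_injective (Λ : Finset V) (ω₀ : V → Fin q) :
    Function.Injective fun η : Λ → Fin q => overwrite Λ η ω₀ := fun η ζ h => by
  simpa using congrArg (restrict Λ) h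

theorem compress_embed (ω₀ : V → Fin q) (Λ : Finset V) (A : FinOp Λ q) :
    compress ω₀ Λ (embed Λ A) = A := by
  classical
  ext ζ η
  simp only [compress_apply, embed_apply, overwrite_overwrite, restrict_overwrite, basisVec_apply,
    (overwrite_injective Λ ω₀).eq_iff]
  simp

theorem compress_one (ω₀ : V → Fin q) (Λ : Finset V) : compress ω₀ Λ 1 = 1 := by
  rw [← map_one (embed Λ), compress_embed]

/-- A local operator on a region avoiding `x` keeps the form `M ⊗ 𝕀_x` under compression, even if
its region sticks out of `Λ`, and `D` annihilates such operators. The condition is closed, so it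
passes to the norm closure. -/
theorem trace_mul_compress_eq_zero (ω₀ : V → Fin q) {Λ : Finset V} {x : Λ} {D : FinOp Λ q}
    (hD : partialTrace x D = 0) {T : Hilb V q →L[ℂ] Hilb V q}
    (hT : T ∈ regionAlgebra q ({x.1}ᶜ : Set V)) : (D * compress ω₀ Λ T).trace = 0 := by
  have hc : Continuous fun T => (D * compress ω₀ Λ T).trace :=
    (continuous_const.matrix_mul (continuous_compress ω₀ Λ)).matrix_trace
  have hcl : IsClosed {T : Hilb V q →L[ℂ] Hilb V q | (D * compress ω₀ Λ T).trace = 0} :=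
    isClosed_eq hc continuous_const
  have hT' : T ∈ closure (strictlyLocalAlgebra q ({x.1}ᶜ : Set V) :
    Set (Hilb V q →L[ℂ] Hilb V q)) := hT
  refine closure_minimal ?_ hcl hT'
  rintro _ ⟨X, hX, A, rfl⟩
  change (D * compress ω₀ Λ (embed X A)).trace = 0
  have hx : x.1 ∉ X := fun h => hX h rfl
  classical
  have hE : ∀ ζ η, compress ω₀ Λ (embed X A) ζ η = ∑ ξ : X → Fin q,
      A (restrict X (overwrite Λ ζ ω₀)) ξ *
        if overwrite X ξ (overwrite Λ ζ ω₀) = overwrite Λ η ω₀ then 1 else 0 := fun ζ η => by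
    rw [compress_apply, embed_apply]
    simp only [basisVec_apply]
  refine trace_mul_eq_zero_of_partialTrace_eq_zero hD ?_ ?_
  · intro ζ η h
    rw [hE]
    refine Finset.sum_eq_zero fun ξ _ => ?_
    rw [if_neg, mul_zero]
    intro h'
    have := congrFun h' x.1
    simp [overwrite, hx] at this
    exact h this
  · intro s t ζ η
    rw [hE, hE]
    have hne : ∀ v : X, v.1 ≠ x.1 := fun v h => hx (h ▸ v.2)
    have h1 : restrict X (overwrite Λ (insertSite x s ζ) ω₀) =
        restrict X (overwrite Λ (insertSite x t ζ) ω₀) := by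
      funext v
      by_cases hv : v.1 ∈ Λ
      · have : (⟨v.1, hv⟩ : Λ) ≠ x := fun h => hne v (congrArg Subtype.val h)
        simp [restrict, overwrite, hv, insertSite, this]
      · simp [restrict, overwrite, hv]
    have h2 : ∀ (s t : Fin q) (ξ : X → Fin q),
        overwrite X ξ (overwrite Λ (insertSite x s ζ) ω₀) = overwrite Λ (insertSite x s η) ω₀ →
        overwrite X ξ (overwrite Λ (insertSite x t ζ) ω₀) = overwrite Λ (insertSite x t η) ω₀ := by
      intro s t ξ h
      funext v
      by_cases hv : v = x.1
      · subst hv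
        simp [overwrite, hx]
      · have h3 := congrFun h v
        by_cases hΛ : v ∈ Λ
        · have : (⟨v, hΛ⟩ : Λ) ≠ x := fun h => hv (congrArg Subtype.val h)
          simpa [overwrite, hΛ, insertSite, this] using h3
        · simpa [overwrite, hΛ] using h3
    rw [h1]
    refine Finset.sum_congr rfl fun ξ _ => ?_
    rw [if_congr ⟨h2 s t ξ, h2 t s ξ⟩ rfl rfl]

end Compress

/-! ### Translations, and the bound valid in every box. -/

section Translate

variable {d q : ℕ}

theorem continuous_shiftOp (x : Site d) :
    Continuous (shiftOp x : (Hilb (Site d) q →L[ℂ] Hilb (Site d) q) → _) :=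
  map_continuous (shiftOp x : (Hilb (Site d) q →L[ℂ] Hilb (Site d) q) ≃⋆ₐ[ℂ] _)

theorem shiftOp_mem_regionAlgebra (x : Site d) {Γ Γ' : Set (Site d)}
    (h : ∀ y ∈ Γ, y + x ∈ Γ') {T : Hilb (Site d) q →L[ℂ] Hilb (Site d) q}
    (hT : T ∈ regionAlgebra q Γ) : shiftOp x T ∈ regionAlgebra q Γ' := by
  refine map_mem_closure (continuous_shiftOp x) hT ?_
  rintro _ ⟨X, hX, A, rfl⟩
  refine ⟨shiftFinset x X, ?_, _, (shiftOp_embed x X A).symm⟩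
  intro y hy
  obtain ⟨z, hz, rfl⟩ := Finset.mem_map.mp hy
  exact h z (hX hz)

theorem norm_shiftOp (x : Site d) (T : Hilb (Site d) q →L[ℂ] Hilb (Site d) q) :
    ‖shiftOp x T‖ = ‖T‖ :=
  NonUnitalStarAlgHom.norm_map (shiftOp x) (shiftOp x).injective T

theorem translate_translate (x y : Site d) (T : QuasiLocal (Site d) q) :
    translate x (translate y T) = translate (x + y) T := by
  apply Subtype.ext
  ext ψ ω
  change (shiftUnitary x) ((shiftUnitary y) (T.1 ((shiftUnitary y).symm
    ((shiftUnitary x).symm ψ)))) ω = shiftUnitary (x + y) (T.1 ((shiftUnitary (x + y)).symm ψ)) ω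
  have h : (shiftUnitary y).symm ((shiftUnitary x).symm ψ) = (shiftUnitary (x + y)).symm ψ := by
    ext ω
    simp only [shiftUnitary_symm_apply]
    exact congrArg ψ (funext fun z => congrArg ω (by abel))
  rw [h]
  simp only [shiftUnitary_apply]
  exact congrArg (T.1 _) (funext fun z => congrArg ω (by abel))

theorem translate_toQuasiLocal (x : Site d) (Λ : Finset (Site d)) (A : FinOp Λ q) :
    translate x (toQuasiLocal Λ A) = toQuasiLocal (shiftFinset x Λ) (shiftFinOp x Λ A) :=
  Subtype.ext (shiftOp_embed x Λ A)

theorem State.EqOn.translate {ρ σ : State (Site d) q} {Γ Γ' : Set (Site d)} {x : Site d}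
    (h : ρ.EqOn σ Γ) (hx : ∀ y ∈ Γ', y - x ∈ Γ) : (ρ.translate x).EqOn (σ.translate x) Γ' :=
  fun T hT => h _ (shiftOp_mem_regionAlgebra (-x)
    (fun y hy => by rw [← sub_eq_add_neg]; exact hx y hy) hT)

theorem card_box_pos (a : Fin d → ℕ+) : 0 < (box a).card := by
  rw [Finset.card_pos]
  refine ⟨0, Fintype.mem_piFinset.mpr fun i => Finset.mem_Ico.mpr ⟨by simp, ?_⟩⟩
  simp

theorem w1Box_le_of_mem_w1NormSet {ρ σ : State (Site d) q} {c : ℝ} (hc : c ∈ w1NormSet ρ σ)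
    (a : Fin d → ℕ+) : w1Box ρ σ a ≤ c := by
  obtain ⟨hc0, ρ', σ', hEq, hsum⟩ := hc
  rw [w1Box, div_le_iff₀ (by exact_mod_cast card_box_pos a)]
  set Λ := box a
  have hc0' : (0 : ℂ) ≤ c := by exact_mod_cast hc0
  have hP : ∀ x : Λ, ((c : ℂ) • (ρ'.translate x.1).marginal Λ).PosSemidef := fun x =>
    ((ρ'.translate x.1).posSemidef_marginal Λ).smul hc0'
  have hN : ∀ x : Λ, ((c : ℂ) • (σ'.translate x.1).marginal Λ).PosSemidef := fun x =>
    ((σ'.translate x.1).posSemidef_marginal Λ).smul hc0'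
  refine (W1Norm_le (D := fun x : Λ => (c : ℂ) • (ρ'.translate x.1).marginal Λ -
    (c : ℂ) • (σ'.translate x.1).marginal Λ) (fun x => ⟨(hP x).isHermitian.sub (hN x).isHermitian,
      ?_, ?_⟩) ?_).trans ?_
  · simp [State.trace_marginal]
  · rw [partialTrace_sub, partialTrace_smul, partialTrace_smul,
      State.partialTrace_marginal_eq x (hEq.translate (x := x.1) fun y hy h => hy ?_), sub_self]
    exact sub_eq_zero.mp h
  · rw [hsum, Finset.smul_sum]
    simp only [smul_sub]
    exact Finset.sum_coe_sort Λ fun x => (c : ℂ) • (ρ'.translate x).marginal Λ -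
      (c : ℂ) • (σ'.translate x).marginal Λ
  · have h : ∀ x : Λ, traceNorm ((c : ℂ) • (ρ'.translate x.1).marginal Λ -
        (c : ℂ) • (σ'.translate x.1).marginal Λ) ≤ 2 * c := fun x => by
      refine (traceNorm_sub_le (hP x) (hN x)).trans (le_of_eq ?_)
      simp [State.trace_marginal, two_mul]
    have := Finset.sum_le_sum fun x (_ : x ∈ Finset.univ) => h x
    simp only [Finset.sum_const, Finset.card_univ, Fintype.card_coe, nsmul_eq_mul] at this
    linarith

end Translate

/-! ### Compactness and normalisation of positive functionals. -/

section Positive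

variable {V : Type*} [DecidableEq V] {q : ℕ}

/-- For `q = 0` the algebra is zero, so `1 = 0` and no state exists. This supplies the value 0 used
to reset sites and to fill the exterior. -/
theorem State.neZero [Nonempty V] (ρ : State V q) : NeZero q := by
  refine ⟨?_⟩
  rintro rfl
  have : IsEmpty (V → Fin 0) := ⟨fun f => (f (Classical.arbitrary V)).elim0⟩
  have h : (1 : QuasiLocal V 0) = 0 := by
    apply Subtype.ext
    ext ψ ω
    exact this.elim ω
  have h1 := ρ.map_one'
  rw [h, map_zero] at h1
  exact zero_ne_one h1

instance isClosed_regionAlgebra (Γ : Set V) :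
    IsClosed (regionAlgebra q Γ : Set (Hilb V q →L[ℂ] Hilb V q)) :=
  isClosed_closure

/-- Pointwise limits of positive functionals with bounded values at the unit. -/
theorem exists_tendsto_of_positive {A α : Type*} [CStarAlgebra A] (U : Ultrafilter α)
    (L : α → A →ₗ[ℂ] ℂ) (hL : ∀ i a, 0 ≤ L i (star a * a)) {b : ℝ} (hb : ∀ i, ‖L i 1‖ ≤ b) :
    ∃ M : A →ₗ[ℂ] ℂ, (∀ a, Filter.Tendsto (fun i => L i a) U (nhds (M a))) ∧
      ∀ a, 0 ≤ M (star a * a) := by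
  have h : ∀ a, ∃ l, Filter.Tendsto (fun i => L i a) U (nhds l) := fun a => by
    have hmem : ∀ i, L i a ∈ Metric.closedBall (0 : ℂ) (4 * b * ‖a‖) := fun i => by
      rw [mem_closedBall_zero_iff]
      exact (norm_apply_le_of_positive (L i) (hL i) a).trans (by gcongr; exact hb i)
    obtain ⟨l, -, hl⟩ := (isCompact_closedBall (0 : ℂ) (4 * b * ‖a‖)).ultrafilter_le_nhds
      (U.map fun i => L i a) (Filter.le_principal_iff.mpr
        (Filter.Eventually.of_forall hmem : ∀ᶠ i in (U : Filter α), _))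
    exact ⟨l, hl⟩
  choose f hf using h
  refine ⟨{ toFun := f, map_add' := fun a b => ?_, map_smul' := fun c a => ?_ }, hf, fun a =>
    ge_of_tendsto' (hf _) fun i => hL i a⟩
  · refine tendsto_nhds_unique (hf (a + b)) ?_
    simpa only [map_add] using (hf a).add (hf b)
  · refine tendsto_nhds_unique (hf (c • a)) ?_
    simpa only [map_smul, RingHom.id_apply] using (hf a).const_smul c

/-- Every positive functional is a multiple of a state. -/
theorem exists_state_of_positive (ρ : State V q) (L : QuasiLocal V q →ₗ[ℂ] ℂ)
    (hL : ∀ T, 0 ≤ L (star T * T)) :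
    ∃ ρ' : State V q, (∀ T, L T = L 1 * ρ'.toLinearMap T) ∧ (L 1 = 0 → ρ' = ρ) := by
  by_cases h : L 1 = 0
  · refine ⟨ρ, fun T => ?_, fun _ => rfl⟩
    have := norm_apply_le_of_positive L hL T
    rw [h, norm_zero, mul_zero, zero_mul, norm_le_zero_iff] at this
    rw [this, h, zero_mul]
  · have h1 : 0 ≤ L 1 := by simpa using hL 1
    refine ⟨⟨(L 1)⁻¹ • L, fun T => ?_, ?_⟩, fun T => ?_, fun h' => absurd h' h⟩
    · exact mul_nonneg (inv_nonneg.mpr h1) (hL T)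
    · exact inv_mul_cancel₀ h
    · exact (mul_inv_cancel_left₀ h _).symm

end Positive

/-! ### Averaged functionals and the reassembly identity. -/

section Average

variable {d q : ℕ}

/-- The functional `T ↦ |B|⁻¹ ∑_{x ∈ B} Tr[(D_x ⊗ |ω₀⟩⟨ω₀|) τ_x T]`. -/
noncomputable def avgFunctional (ω₀ : Site d → Fin q) (B : Finset (Site d))
    (D : B → FinOp B q) : QuasiLocal (Site d) q →ₗ[ℂ] ℂ where
  toFun T := (B.card : ℂ)⁻¹ * ∑ x : B, (D x * compress ω₀ B (shiftOp x.1 T.1)).trace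
  map_add' S T := by
    rw [← mul_add, ← Finset.sum_add_distrib]
    simp only [← Matrix.trace_add, ← mul_add, ← map_add]
    rfl
  map_smul' c T := by
    have : ∀ x : B, (D x * compress ω₀ B (shiftOp x.1 (c • T).1)).trace =
        c * (D x * compress ω₀ B (shiftOp x.1 T.1)).trace := fun x => by
      rw [show (c • T).1 = c • T.1 from rfl, map_smul, map_smul, Matrix.mul_smul,
        Matrix.trace_smul, smul_eq_mul]
    simp only [this, ← Finset.mul_sum, RingHom.id_apply, smul_eq_mul]
    ring

variable (ω₀ : Site d → Fin q) (B : Finset (Site d))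

theorem avgFunctional_apply (D : B → FinOp B q) (T : QuasiLocal (Site d) q) :
    avgFunctional ω₀ B D T =
      (B.card : ℂ)⁻¹ * ∑ x : B, (D x * compress ω₀ B (shiftOp x.1 T.1)).trace := rfl

theorem avgFunctional_nonneg {D : B → FinOp B q} (hD : ∀ x, (D x).PosSemidef)
    (T : QuasiLocal (Site d) q) : 0 ≤ avgFunctional ω₀ B D (star T * T) := by
  refine mul_nonneg (by positivity) (Finset.sum_nonneg fun x _ => trace_mul_nonneg (hD x) ?_)
  have : shiftOp x.1 (star T * T).1 = star (shiftOp x.1 T.1) * shiftOp x.1 T.1 := by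
    rw [← map_star, ← map_mul]; rfl
  rw [this]
  exact posSemidef_compress ω₀ B _

theorem avgFunctional_one (D : B → FinOp B q) :
    avgFunctional ω₀ B D 1 = (B.card : ℂ)⁻¹ * ∑ x, (D x).trace := by
  have : ∀ x : Site d, shiftOp x (1 : QuasiLocal (Site d) q).1 = 1 := fun x =>
    map_one (shiftOp x)
  simp only [avgFunctional_apply, this, compress_one, mul_one]

theorem avgFunctional_sub (P N : B → FinOp B q) (T : QuasiLocal (Site d) q) :
    avgFunctional ω₀ B P T - avgFunctional ω₀ B N T = avgFunctional ω₀ B (P - N) T := by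
  simp only [avgFunctional_apply, ← mul_sub, ← Finset.sum_sub_distrib, Pi.sub_apply, sub_mul,
    Matrix.trace_sub]

theorem avgFunctional_eq_zero {D : B → FinOp B q} (hD : ∀ x, partialTrace x (D x) = 0)
    {T : QuasiLocal (Site d) q} (hT : T.1 ∈ regionAlgebra q ({0}ᶜ : Set (Site d))) :
    avgFunctional ω₀ B D T = 0 := by
  rw [avgFunctional_apply, Finset.sum_eq_zero, mul_zero]
  refine fun x _ => trace_mul_compress_eq_zero ω₀ (hD x)
    (shiftOp_mem_regionAlgebra x.1 (fun y hy => ?_) hT)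
  simpa using hy

/-- The substitution `z = x - y` for each fixed `x`; the extra points of `Z` contribute nothing by
`hf`. -/
theorem sum_sum_sub_eq {M : Type*} [AddCommMonoid M] (Λ Z : Finset (Site d))
    (f : B → Site d → M) (hZ : ∀ x ∈ B, ∀ y ∈ Λ, x - y ∈ Z)
    (hf : ∀ (x : B) (z : Site d), x.1 - z ∉ Λ → f x z = 0) :
    ∑ y ∈ Λ, ∑ x : B, f x (x.1 - y) = ∑ z ∈ Z, ∑ x : B, f x z := by
  rw [Finset.sum_comm, Finset.sum_comm (s := Z)]
  refine Finset.sum_congr rfl fun x _ => ?_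
  refine Finset.sum_of_injOn (fun y => x.1 - y) (fun y _ z _ h => by simpa using h)
    (fun y hy => hZ x.1 x.2 y hy) (fun z _ hz => hf x z fun h => hz ⟨_, h, ?_⟩) (fun _ _ => rfl)
  exact sub_sub_cancel _ _

theorem trace_mul_compress_translate_eq_zero {x : B} {D : FinOp B q} (hD : partialTrace x D = 0)
    {Λ : Finset (Site d)} (A : FinOp Λ q) {z : Site d} (hz : x.1 - z ∉ Λ) :
    (D * compress ω₀ B (translate z (toQuasiLocal Λ A)).1).trace = 0 := by
  refine trace_mul_compress_eq_zero ω₀ hD ?_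
  rw [translate_toQuasiLocal]
  refine StarSubalgebra.le_topologicalClosure _ ⟨_, ?_, _, rfl⟩
  rintro w hw rfl
  obtain ⟨y, hy, hyx⟩ := Finset.mem_map.mp (Finset.mem_coe.mp hw)
  have : y + z = x.1 := hyx
  exact hz (by rwa [← this, add_sub_cancel_right])

theorem avgFunctional_translate_neg (D : B → FinOp B q) (y : Site d)
    (T : QuasiLocal (Site d) q) :
    avgFunctional ω₀ B D (translate (-y) T) = (B.card : ℂ)⁻¹ *
      ∑ x : B, (D x * compress ω₀ B (translate (x.1 - y) T).1).trace := by
  rw [avgFunctional_apply]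
  congr 1
  refine Finset.sum_congr rfl fun x _ => ?_
  rw [sub_eq_add_neg, ← translate_translate]
  rfl

/-- For fixed `z`, only the `D x` with `x ∈ Λ + z` see `τ_z A`. After substituting `z = x - y`, the
missing terms can therefore be added for free, and only the total `∑ x, D x` remains. -/
theorem sum_avgFunctional_translate {D : B → FinOp B q} (hD : ∀ x, partialTrace x (D x) = 0)
    (Λ : Finset (Site d)) (A : FinOp Λ q) {Z : Finset (Site d)}
    (hZ : ∀ x ∈ B, ∀ y ∈ Λ, x - y ∈ Z) :
    ∑ y ∈ Λ, avgFunctional ω₀ B D (translate (-y) (toQuasiLocal Λ A)) = (B.card : ℂ)⁻¹ *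
      ∑ z ∈ Z, ((∑ x, D x) * compress ω₀ B (translate z (toQuasiLocal Λ A)).1).trace := by
  simp only [avgFunctional_translate_neg, ← Finset.mul_sum]
  rw [sum_sum_sub_eq B Λ Z
    (fun x z => (D x * compress ω₀ B (translate z (toQuasiLocal Λ A)).1).trace) hZ
    fun x z hz => trace_mul_compress_translate_eq_zero ω₀ B (hD x) A hz]
  simp only [Finset.sum_mul, Matrix.trace_sum]

theorem trace_marginal_mul_compress (ρ : State (Site d) q) {X : Finset (Site d)} (h : X ⊆ B)
    (A : FinOp X q) :
    (ρ.marginal B * compress ω₀ B (toQuasiLocal X A).1).trace =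
      ρ.toLinearMap (toQuasiLocal X A) := by
  rw [← toQuasiLocal_extendOp h, ← ρ.trace_marginal_mul]
  congr 2
  exact compress_embed ω₀ B _

theorem norm_trace_marginal_mul_compress_le (ρ : State (Site d) q) (T : QuasiLocal (Site d) q) :
    ‖(ρ.marginal B * compress ω₀ B T.1).trace‖ ≤ 4 * ‖T‖ := by
  let L : QuasiLocal (Site d) q →ₗ[ℂ] ℂ :=
    Matrix.traceLinearMap _ ℂ ℂ ∘ₗ LinearMap.mulLeft ℂ (ρ.marginal B) ∘ₗ compress ω₀ B ∘ₗ
      (regionAlgebra q Set.univ).subtype.toLinearMap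
  have h1 : L 1 = 1 := by
    change (ρ.marginal B * compress ω₀ B 1).trace = 1
    rw [compress_one, mul_one, ρ.trace_marginal]
  have := norm_apply_le_of_positive L (fun T => trace_mul_nonneg (ρ.posSemidef_marginal B)
    (posSemidef_compress ω₀ B T.1)) T
  rwa [h1, norm_one, mul_one] at this

theorem State.IsTranslationInvariant.apply_translate {ρ : State (Site d) q}
    (hρ : ρ.IsTranslationInvariant) (x : Site d) (T : QuasiLocal (Site d) q) :
    ρ.toLinearMap (SpinLattice.translate x T) = ρ.toLinearMap T := by
  have := congrArg (fun τ => τ.toLinearMap T) (hρ (-x))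
  simpa [State.translate] using this

end Average

/-! ### Boundary effects in large boxes. -/

section Boxes

variable {d : ℕ}

/-- The box `Λ_a` with every face moved outwards by `R`. -/
noncomputable def thickBox (R : ℤ) (a : Fin d → ℕ+) : Finset (Site d) :=
  Fintype.piFinset fun i => Finset.Ico (-((a i : ℕ) : ℤ) - R) (((a i : ℕ) : ℤ) + R)

theorem mem_thickBox {R : ℤ} {a : Fin d → ℕ+} {x : Site d} :
    x ∈ thickBox R a ↔ ∀ i, -((a i : ℕ) : ℤ) - R ≤ x i ∧ x i < ((a i : ℕ) : ℤ) + R := by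
  simp [thickBox]

theorem mem_box {a : Fin d → ℕ+} {x : Site d} :
    x ∈ box a ↔ ∀ i, -((a i : ℕ) : ℤ) ≤ x i ∧ x i < ((a i : ℕ) : ℤ) := by
  simp [box]

theorem tendsto_coord_atTop (i : Fin d) :
    Filter.Tendsto (fun a : Fin d → ℕ+ => ((a i : ℕ) : ℝ)) Filter.atTop Filter.atTop :=
  tendsto_natCast_atTop_atTop.comp (tendsto_PNat_val_atTop_atTop.comp
    (Filter.tendsto_atTop_atTop.mpr fun b => ⟨fun _ => b, fun _ ha => ha i⟩))

theorem tendsto_card_thickBox_div (R : ℤ) :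
    Filter.Tendsto (fun a : Fin d → ℕ+ => ((thickBox R a).card : ℝ) / (box a).card)
      Filter.atTop (nhds 1) := by
  have h : ∀ i : Fin d, Filter.Tendsto (fun a : Fin d → ℕ+ =>
      (((((a i : ℕ) : ℤ) + R - (-((a i : ℕ) : ℤ) - R)).toNat : ℕ) : ℝ) /
        (((((a i : ℕ) : ℤ) - -((a i : ℕ) : ℤ)).toNat : ℕ) : ℝ)) Filter.atTop (nhds 1) := by
    intro i
    have h1 : Filter.Tendsto (fun a : Fin d → ℕ+ => 1 + (R : ℝ) / ((a i : ℕ) : ℝ))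
        Filter.atTop (nhds 1) := by
      simpa using ((tendsto_coord_atTop i).const_div_atTop (R : ℝ)).const_add 1
    refine h1.congr' ?_
    -- `R` may be negative; once `a i ≥ -R` the truncation in `toNat` is harmless.
    filter_upwards [(tendsto_coord_atTop i).eventually_ge_atTop (-(R : ℝ))] with a ha
    have hpos : (0 : ℝ) < ((a i : ℕ) : ℝ) := by exact_mod_cast (a i).pos
    have ha' : -R ≤ ((a i : ℕ) : ℤ) := by exact_mod_cast ha
    have e1 : (((((a i : ℕ) : ℤ) + R - (-((a i : ℕ) : ℤ) - R)).toNat : ℕ) : ℝ) =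
        2 * ((a i : ℕ) : ℝ) + 2 * R := by
      have : ((((a i : ℕ) : ℤ) + R - (-((a i : ℕ) : ℤ) - R)).toNat : ℤ) =
        2 * ((a i : ℕ) : ℤ) + 2 * R := by omega
      exact_mod_cast this
    have e2 : (((((a i : ℕ) : ℤ) - -((a i : ℕ) : ℤ)).toNat : ℕ) : ℝ) =
        2 * ((a i : ℕ) : ℝ) := by
      have : ((((a i : ℕ) : ℤ) - -((a i : ℕ) : ℤ)).toNat : ℤ) = 2 * ((a i : ℕ) : ℤ) := by omega
      exact_mod_cast this
    rw [e1, e2]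
    field_simp
  have h2 := tendsto_finsetProd Finset.univ fun i (_ : i ∈ Finset.univ) => h i
  simp only [Finset.prod_const_one] at h2
  refine h2.congr fun a => ?_
  simp [thickBox, box, Fintype.card_piFinset, Int.card_Ico, Finset.prod_div_distrib]

/-- Averages over boxes are insensitive to the boundary. -/
theorem tendsto_sum_thickBox {R : ℕ} {h : (Fin d → ℕ+) → Site d → ℂ} {v : ℂ} {K : ℝ}
    (hv : ∀ a, ∀ z ∈ thickBox (-R) a, h a z = v) (hK : ∀ a z, ‖h a z‖ ≤ K) :
    Filter.Tendsto (fun a => ((box a).card : ℂ)⁻¹ * ∑ z ∈ thickBox R a, h a z)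
      Filter.atTop (nhds v) := by
  -- The first term bounds the shell between the inner and outer boxes, the second the deviation of
  -- the inner volume fraction from 1.
  have hlim : Filter.Tendsto (fun a : Fin d → ℕ+ =>
      K * (((thickBox R a).card : ℝ) / (box a).card -
        ((thickBox (-R) a).card : ℝ) / (box a).card) +
      ‖v‖ * |((thickBox (-R) a).card : ℝ) / (box a).card - 1|) Filter.atTop (nhds 0) := by
    have h1 := tendsto_card_thickBox_div (d := d) R
    have h2 := tendsto_card_thickBox_div (d := d) (-R)
    simpa using ((h1.sub h2).const_mul K).add ((h2.sub_const 1).abs.const_mul ‖v‖)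
  rw [tendsto_iff_norm_sub_tendsto_zero]
  refine squeeze_zero (fun _ => norm_nonneg _) (fun a => ?_) hlim
  have hsub : thickBox (-(R : ℤ)) a ⊆ thickBox R a := fun z hz => by
    rw [mem_thickBox] at hz ⊢
    intro i
    have := hz i
    omega
  have hn : (0 : ℝ) < (box a).card := by exact_mod_cast card_box_pos a
  have hn' : ((box a).card : ℂ) ≠ 0 := by exact_mod_cast hn.ne'
  rw [← Finset.sum_sdiff hsub, Finset.sum_congr rfl (hv a), Finset.sum_const, nsmul_eq_mul]
  have e : ((box a).card : ℂ)⁻¹ * (∑ z ∈ thickBox R a \ thickBox (-R) a, h a z +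
      ((thickBox (-R) a).card : ℂ) * v) - v =
      ((box a).card : ℂ)⁻¹ * (∑ z ∈ thickBox R a \ thickBox (-R) a, h a z) +
      v * (((((thickBox (-R) a).card : ℝ) / (box a).card - 1 : ℝ)) : ℂ) := by
    push_cast
    field_simp
    ring
  rw [e]
  refine (norm_add_le _ _).trans (add_le_add ?_ ?_)
  · rw [norm_mul, norm_inv, Complex.norm_natCast, inv_mul_le_iff₀ hn]
    refine (norm_sum_le_of_le _ fun z _ => hK a z).trans (le_of_eq ?_)
    rw [Finset.sum_const, nsmul_eq_mul, Finset.cast_card_sdiff hsub]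
    field_simp
  · rw [norm_mul, Complex.norm_real, Real.norm_eq_abs]

theorem exists_bound (Λ : Finset (Site d)) : ∃ R : ℕ, ∀ y ∈ Λ, ∀ i, |y i| ≤ R := by
  refine ⟨Λ.sup fun y => Finset.univ.sup fun i => (y i).natAbs, fun y hy i => ?_⟩
  have h1 : (y i).natAbs ≤ Finset.univ.sup fun i => (y i).natAbs :=
    Finset.le_sup (f := fun i => (y i).natAbs) (Finset.mem_univ i)
  have h2 := h1.trans (Finset.le_sup (f := fun y : Site d => Finset.univ.sup
    fun i => (y i).natAbs) hy)
  rw [Int.abs_eq_natAbs]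
  exact_mod_cast h2

end Boxes

/-! ### The compactness argument and the conclusion. -/

section Main

variable {d q : ℕ} {ρ σ : State (Site d) q}

theorem exists_functionals_of_w1Box_lt {b : ℝ} {a : Fin d → ℕ+} (h : w1Box ρ σ a < b)
    (ω₀ : Site d → Fin q) :
    ∃ L M : QuasiLocal (Site d) q →ₗ[ℂ] ℂ,
      (∀ T, 0 ≤ L (star T * T)) ∧ (∀ T, 0 ≤ M (star T * T)) ∧ L 1 = M 1 ∧ ‖L 1‖ ≤ b ∧
      (∀ T : QuasiLocal (Site d) q, T.1 ∈ regionAlgebra q ({0}ᶜ : Set (Site d)) → L T = M T) ∧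
      ∀ (Λ Z : Finset (Site d)) (A : FinOp Λ q), (∀ x ∈ box a, ∀ y ∈ Λ, x - y ∈ Z) →
        ∑ y ∈ Λ, (L (translate (-y) (toQuasiLocal Λ A)) - M (translate (-y) (toQuasiLocal Λ A))) =
          ((box a).card : ℂ)⁻¹ * ∑ z ∈ Z, ((ρ.marginal (box a) - σ.marginal (box a)) *
            compress ω₀ (box a) (translate z (toQuasiLocal Λ A)).1).trace := by
  have := ρ.neZero
  have hn : (0 : ℝ) < (box a).card := by exact_mod_cast card_box_pos a
  rw [w1Box, div_lt_iff₀ hn] at h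
  obtain ⟨D, hD, hsum, hlt⟩ := exists_decomposition_lt (ρ.posSemidef_marginal _)
    (σ.posSemidef_marginal _) (ρ.trace_marginal _) (σ.trace_marginal _) h
  choose P N hP hN hPN htr using fun x => exists_posSemidef_sub_eq (hD x).1
  have hDPN : P - N = D := funext hPN
  have htrEq : ∀ x, (P x).trace = (N x).trace := fun x => by
    have := (hD x).2.1
    rwa [← hPN, Matrix.trace_sub, sub_eq_zero] at this
  have hD0 : ∀ x, partialTrace x ((P - N) x) = 0 := fun x => by rw [hDPN]; exact (hD x).2.2
  refine ⟨avgFunctional ω₀ (box a) P, avgFunctional ω₀ (box a) N,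
    avgFunctional_nonneg ω₀ _ hP, avgFunctional_nonneg ω₀ _ hN, ?_, ?_, ?_, ?_⟩
  · rw [avgFunctional_one, avgFunctional_one, Finset.sum_congr rfl fun x _ => htrEq x]
  -- As `D x` is traceless, both Jordan parts have trace half its trace norm; hence the mass of the
  -- functionals is exactly half the cost per site.
  · have h2 : ∑ x, (P x).trace = (((1 / 2 : ℝ) * ∑ x, traceNorm (D x) : ℝ) : ℂ) := by
      push_cast
      rw [Finset.mul_sum]
      refine Finset.sum_congr rfl fun x _ => ?_
      rw [htr, ← htrEq]
      ring
    have h3 : 0 ≤ ∑ x, traceNorm (D x) := Finset.sum_nonneg fun x _ => traceNorm_nonneg _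
    rw [avgFunctional_one, h2, norm_mul, norm_inv, Complex.norm_natCast, Complex.norm_real,
      Real.norm_of_nonneg (by positivity), inv_mul_le_iff₀ hn]
    linarith
  · intro T hT
    rw [← sub_eq_zero, avgFunctional_sub]
    exact avgFunctional_eq_zero ω₀ _ hD0 hT
  · intro Λ Z A hZ
    simp only [avgFunctional_sub]
    rw [sum_avgFunctional_translate ω₀ _ hD0 Λ A hZ, hDPN, hsum]

/-- If `z` has distance at least `R` from the boundary, `Λ + z` lies in the box and invariance gives
the same value for all such `z`. The other terms are bounded by 4 times the norm for each state,
hence 8. -/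
theorem tendsto_sum_trace_compress (hρ : ρ.IsTranslationInvariant)
    (hσ : σ.IsTranslationInvariant) (ω₀ : Site d → Fin q) {Λ : Finset (Site d)} {R : ℕ}
    (hR : ∀ y ∈ Λ, ∀ i, |y i| ≤ R) (A : FinOp Λ q) :
    Filter.Tendsto (fun a => ((box a).card : ℂ)⁻¹ * ∑ z ∈ thickBox R a,
      ((ρ.marginal (box a) - σ.marginal (box a)) *
        compress ω₀ (box a) (translate z (toQuasiLocal Λ A)).1).trace) Filter.atTop
      (nhds (ρ.toLinearMap (toQuasiLocal Λ A) - σ.toLinearMap (toQuasiLocal Λ A))) := by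
  refine tendsto_sum_thickBox (K := 8 * ‖toQuasiLocal Λ A‖) (fun a z hz => ?_) fun a z => ?_
  · have hsub : shiftFinset z Λ ⊆ box a := by
      intro w hw
      obtain ⟨y, hy, rfl⟩ := Finset.mem_map.mp hw
      rw [mem_thickBox] at hz
      rw [mem_box]
      intro i
      have h1 := hz i
      have h2 := abs_le.mp (hR y hy i)
      change _ ≤ y i + z i ∧ y i + z i < _
      omega
    rw [sub_mul, Matrix.trace_sub, translate_toQuasiLocal,
      trace_marginal_mul_compress ω₀ _ ρ hsub, trace_marginal_mul_compress ω₀ _ σ hsub,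
      ← translate_toQuasiLocal, hρ.apply_translate, hσ.apply_translate]
  · have hnorm : ‖translate z (toQuasiLocal Λ A)‖ = ‖toQuasiLocal Λ A‖ := norm_shiftOp z _
    rw [sub_mul, Matrix.trace_sub]
    have h1 := norm_trace_marginal_mul_compress_le ω₀ (box a) ρ (translate z (toQuasiLocal Λ A))
    have h2 := norm_trace_marginal_mul_compress_le ω₀ (box a) σ (translate z (toQuasiLocal Λ A))
    rw [hnorm] at h1 h2
    exact (norm_sub_le _ _).trans (by linarith)

/-- Only a cofinal family of good boxes is assumed; this is what makes the argument bound the lower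
limit and so prove convergence. -/
theorem exists_mem_w1NormSet_le (hρ : ρ.IsTranslationInvariant) (hσ : σ.IsTranslationInvariant)
    {b : ℝ} (h : ∃ᶠ a in Filter.atTop, w1Box ρ σ a < b) : ∃ c ∈ w1NormSet ρ σ, c ≤ b := by
  have := ρ.neZero
  let ω₀ : Site d → Fin q := 0
  -- The ultrafilter lives on the good boxes alone, so a pair of functionals can be chosen for each
  -- of its indices.
  have hne : (Filter.comap (Subtype.val : {a // w1Box ρ σ a < b} → _) Filter.atTop).NeBot :=
    Filter.comap_neBot_iff_frequently.mpr (h.mono fun a ha => ⟨⟨a, ha⟩, rfl⟩)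
  let U := Ultrafilter.of (Filter.comap (Subtype.val : {a // w1Box ρ σ a < b} → _) Filter.atTop)
  have hU : Filter.Tendsto (Subtype.val : {a // w1Box ρ σ a < b} → _) U Filter.atTop :=
    Filter.tendsto_comap.mono_left (Ultrafilter.of_le _)
  choose L M hL hM hLM1 hLb hLM hsum using fun a : {a // w1Box ρ σ a < b} =>
    exists_functionals_of_w1Box_lt a.2 ω₀
  obtain ⟨P, hP, hPpos⟩ := exists_tendsto_of_positive U L hL hLb
  obtain ⟨N, hN, hNpos⟩ := exists_tendsto_of_positive U M hM fun a => hLM1 a ▸ hLb a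
  have h1 : P 1 = N 1 := tendsto_nhds_unique (hP 1) ((hN 1).congr fun a => (hLM1 a).symm)
  have hEq : ∀ T : QuasiLocal (Site d) q, T.1 ∈ regionAlgebra q ({0}ᶜ : Set (Site d)) →
      P T = N T := fun T hT =>
    tendsto_nhds_unique (hP T) ((hN T).congr fun a => (hLM a T hT).symm)
  have hbound : ‖P 1‖ ≤ b := le_of_tendsto' (hP 1).norm hLb
  have hP1 : (‖P 1‖ : ℂ) = P 1 :=
    Complex.norm_of_nonneg' (by simpa using hPpos 1)
  obtain ⟨ρ', hρ', hρ0⟩ := exists_state_of_positive ρ P hPpos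
  obtain ⟨σ', hσ', hσ0⟩ := exists_state_of_positive ρ N hNpos
  refine ⟨‖P 1‖, ⟨norm_nonneg _, ρ', σ', ?_, fun Λ => ?_⟩, hbound⟩
  · intro T hT
    -- When the limit mass is 0 the functionals determine no states; both then default to `ρ`, so
    -- the marginals still agree.
    by_cases h0 : P 1 = 0
    · rw [hρ0 h0, hσ0 (h1 ▸ h0)]
    · have := hEq T hT
      rw [hρ', hσ', ← h1] at this
      exact mul_left_cancel₀ h0 this
  · ext η ζ
    obtain ⟨R, hR⟩ := exists_bound Λ
    set A := Matrix.single ζ η (1 : ℂ) with hA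
    have hlim := (tendsto_sum_trace_compress hρ hσ ω₀ hR A).comp hU
    have hlim' := tendsto_finsetSum Λ fun y (_ : y ∈ Λ) =>
      (hP (translate (-y) (toQuasiLocal Λ A))).sub (hN (translate (-y) (toQuasiLocal Λ A)))
    -- The differences `x - y` stay in the box enlarged by `R`, which serves as the summation range
    -- `Z`.
    have key := tendsto_nhds_unique hlim (hlim'.congr fun a => by
      refine hsum a Λ (thickBox R a.1) A fun x hx y hy => ?_
      rw [mem_box] at hx
      rw [mem_thickBox]
      intro i
      have h1 := hx i
      have h2 := abs_le.mp (hR y hy i)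
      change _ ≤ x i - y i ∧ x i - y i < _
      omega)
    rw [Matrix.smul_apply, Matrix.sum_apply, hP1, smul_eq_mul, Finset.mul_sum]
    refine key.trans (Finset.sum_congr rfl fun y _ => ?_)
    rw [hρ', hσ', ← h1, ← mul_sub]
    rfl

/-- The resetting decomposition costs at most 4 per site, so the distance per site is at most 2. Any
strict bound makes the admissible set nonempty. -/
theorem w1Box_lt (ρ σ : State (Site d) q) (a : Fin d → ℕ+) : w1Box ρ σ a < 3 := by
  have := ρ.neZero
  have hn : (0 : ℝ) < (box a).card := by exact_mod_cast card_box_pos a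
  obtain ⟨D, hD, hsum, hle⟩ := exists_decomposition (ρ.posSemidef_marginal (box a))
    (σ.posSemidef_marginal (box a)) (ρ.trace_marginal _) (σ.trace_marginal _)
  have := W1Norm_le hD hsum
  rw [Fintype.card_coe] at hle
  rw [w1Box, div_lt_iff₀ hn]
  linarith

end Main

end SpinLattice

theorem mainTheorem4 (d q : ℕ) (ρ σ : SpinLattice.State (SpinLattice.Site d) q)
    (hρ : ρ.IsTranslationInvariant) (hσ : σ.IsTranslationInvariant) :
    Filter.Tendsto (SpinLattice.w1Box ρ σ) Filter.atTop (nhds (SpinLattice.w1 ρ σ)) ∧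
    (SpinLattice.w1NormSet ρ σ).Nonempty ∧
    SpinLattice.w1 ρ σ = SpinLattice.w1Norm ρ σ := by
  obtain ⟨c₀, hc₀, -⟩ := SpinLattice.exists_mem_w1NormSet_le hρ hσ (b := 3)
    (Filter.Frequently.of_forall fun a => SpinLattice.w1Box_lt ρ σ a)
  have hbdd : BddBelow (SpinLattice.w1NormSet ρ σ) := ⟨0, fun c hc => hc.1⟩
  have hlim : Filter.Tendsto (SpinLattice.w1Box ρ σ) Filter.atTop
      (nhds (SpinLattice.w1Norm ρ σ)) := by
    rw [tendsto_order]
    constructor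
    · intro b hb
      -- Failure of the eventual lower bound gives frequently `w1Box ≤ b`; the room up to `b'` makes
      -- this strict and still contradicts the infimum.
      obtain ⟨b', hbb', hb'⟩ := exists_between hb
      by_contra hcon
      obtain ⟨c, hc, hcb⟩ := SpinLattice.exists_mem_w1NormSet_le hρ hσ (b := b')
        ((Filter.not_eventually.mp hcon).mono fun a ha => (not_lt.mp ha).trans_lt hbb')
      exact (hb'.trans_le ((csInf_le hbdd hc).trans hcb)).false
    · intro b hb
      exact Filter.Eventually.of_forall fun a =>
        (le_csInf ⟨c₀, hc₀⟩ fun c hc => SpinLattice.w1Box_le_of_mem_w1NormSet hc a).trans_lt hb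
  have hw : SpinLattice.w1 ρ σ = SpinLattice.w1Norm ρ σ := hlim.limUnder_eq
  exact ⟨hw ▸ hlim, ⟨c₀, hc₀⟩, hw⟩
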